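/- For every integer $d \ge 1$ and every real $\varepsilon$ with $0 < \varepsilon < 1$ there are constants $C, c > 0$, depending only on $d$ and $\varepsilon$, such that the following holds. For a finite set $V \subset \mathbb{C}^d$ and an integer $r$, let $\mathbf{AP}_r(V)$ be the number of $r$-term arithmetic progressions contained in $V$, that is, of sets of $r$ distinct points of the form $\{y, y+x, y+2x, \ldots, y+(r-1)x\} \subset V$ with $x, y \in \mathbb{C}^d$. Let $V \subset \mathbb{C}^d$ be a set of $n$ points and suppose that for some integer $r \ge 4$ $$\mathbf{AP}_r(V) \ \ge\ C\,\frac{n^2}{r^{d-\varepsilon}}.$$ Then there exists a subset $\tilde V \subset V$ of size $$|\tilde V| \ \ge\ c\,\frac{n}{r^{2d/\varepsilon-1}}$$ that is contained in an affine hyperplane of $\mathbb{C}^d$. -/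

import Mathlib

/-- `P` is an `r`-term arithmetic progression in `ℂ^d`: a set of exactly `r` points of the form
`{y, y + x, y + 2x, …, y + (r - 1)x}`. As the set has `r` elements, `x ≠ 0` whenever `r ≥ 2`. -/
def IsTermAP {d : ℕ} (r : ℕ) (P : Finset (Fin d → ℂ)) : Prop :=
  P.card = r ∧ ∃ y x : Fin d → ℂ, (P : Set (Fin d → ℂ)) = {p | ∃ k < r, p = y + (k : ℂ) • x}

open Classical in
/-- The number of `r`-term arithmetic progressions contained in the finite set `V ⊂ ℂ^d`,
progressions being counted as sets. -/
noncomputable def numAP {d : ℕ} (r : ℕ) (V : Finset (Fin d → ℂ)) : ℕ :=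
  (V.powerset.filter (fun P => IsTermAP r P)).card

/-- `H` is an affine hyperplane of `ℂ^d`: the solution set of one equation
`a₁ x₁ + ⋯ + a_d x_d = b` with `a ≠ 0`. -/
def IsAffineHyperplane {d : ℕ} (H : Set (Fin d → ℂ)) : Prop :=
  ∃ (a : Fin d → ℂ) (b : ℂ), a ≠ 0 ∧ H = {x | ∑ i, a i * x i = b}

/-! ### Positive definite matrices: Cauchy–Schwarz and rank-one updates. -/

section

open Matrix
open scoped ComplexOrder

/-! The proof is a polynomial method resting on a rank bound. Counting progressions by their short
steps (`numAP_le`) bounds their number by a constant times `(1/r) ∑ s²`, over the lines carrying `s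
≥ r` points of `V`. If there are many progressions, then `exists_pruned_subset` yields a nonempty `S
⊆ V` such that, through each point of `S`, the lines with more than `r/2` points of `S` have total
size at least some `κ`, of order at least `r * numAP r V / #V`.

Polynomials of degree at most `g ≈ r/(16d)` in each variable form a space of dimension `(g+1)^d`. On
each line they have degree less than `h = d*g + 1`, small compared with the `r/2` points of `S` on a
heavy line. By `finrank_mul_le_of_blocks` their restrictions to `S` span a space of dimension at
most `4h * #S / κ`, which is below `(g+1)^d` under the hypothesis, so some nonzero polynomial
vanishes on `S`. Replacing it by an iterated partial derivative gives one whose gradient is nonzero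
at some `p ∈ S`. Heavy lines through `p` contain more zeros than the degree, so they lie in the
tangent hyperplane at `p`, which therefore contains at least `κ/2` points of `V`.

For the rank bound, `exists_balanced_weights` chooses weights on the points, by nearly minimizing a
combination of log determinants, so that on average no point has excessive leverage on its lines. In
the weighted Hilbert space, the diagonal entries of the orthogonal projection onto the function
space are then at most `4h/κ`, and their sum, the trace, is the dimension. -/

theorem Matrix.PosDef.normSq_dotProduct_le {n : Type*} [Fintype n] [DecidableEq n]
    {G : Matrix n n ℂ} (hG : G.PosDef) (v c : n → ℂ) :
    Complex.normSq (star v ⬝ᵥ c) ≤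
      (star v ⬝ᵥ G⁻¹ *ᵥ v).re * (star c ⬝ᵥ G *ᵥ c).re := by
  have hdet : IsUnit G.det := (Matrix.isUnit_iff_isUnit_det _).1 hG.isUnit
  set w := G⁻¹ *ᵥ v with hw
  have hGw : G *ᵥ w = v := by
    rw [hw, mulVec_mulVec, Matrix.mul_nonsing_inv _ hdet, one_mulVec]
  by_cases hv : v = 0
  · simp [hv]
  have hinv := hG.inv
  have hpos : 0 < (star v ⬝ᵥ w).re := hinv.re_dotProduct_pos hv
  have him : (star v ⬝ᵥ w).im = 0 := by
    have := (hinv.dotProduct_mulVec_pos hv).le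
    exact ((Complex.le_def.1 this).2).symm
  set a := star v ⬝ᵥ c with ha
  have hca : star c ⬝ᵥ v = star a := by
    rw [ha, ← star_dotProduct_star, star_star, dotProduct_comm]
  have hwv : star w ⬝ᵥ v = star v ⬝ᵥ w := by
    have : star w ⬝ᵥ v = star (star v ⬝ᵥ w) := by
      rw [← star_dotProduct_star, star_star, dotProduct_comm]
    rw [this]
    apply Complex.ext <;> simp [him]
  have hwGc : star w ⬝ᵥ G *ᵥ c = a := by
    rw [ha, ← hGw, star_mulVec G w, hG.isHermitian.eq, ← dotProduct_mulVec]
  set s := (star v ⬝ᵥ w).re with hs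
  have hsc : star v ⬝ᵥ w = (s : ℂ) := by
    apply Complex.ext <;> simp [him, hs]
  -- Discriminant argument without division: `s • c - a • w` is `s` times the component of `c` that
  -- is `G`-orthogonal to `w = G⁻¹ v`.
  have key : 0 ≤ (star ((s : ℂ) • c - a • w) ⬝ᵥ G *ᵥ ((s : ℂ) • c - a • w)).re :=
    hG.posSemidef.re_dotProduct_nonneg ((s : ℂ) • c - a • w)
  have expand : star ((s : ℂ) • c - a • w) ⬝ᵥ G *ᵥ ((s : ℂ) • c - a • w)
      = (s : ℂ) ^ 2 * (star c ⬝ᵥ G *ᵥ c) - (s : ℂ) * (a * star a) := by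
    simp only [star_sub, star_smul, mulVec_sub, mulVec_smul, sub_dotProduct, dotProduct_sub,
      smul_dotProduct, dotProduct_smul, hGw, hca, hwv, hwGc, hsc, smul_eq_mul]
    have : star (s : ℂ) = s := Complex.conj_ofReal s
    rw [this]
    ring
  rw [expand] at key
  have h1 : a * star a = ((Complex.normSq a : ℝ) : ℂ) := Complex.mul_conj a
  rw [h1] at key
  have h2 : ((s : ℂ) ^ 2 * (star c ⬝ᵥ G *ᵥ c) - (s : ℂ) * ((Complex.normSq a : ℝ) : ℂ)).re
      = s * (s * (star c ⬝ᵥ G *ᵥ c).re - Complex.normSq a) := by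
    rw [← Complex.ofReal_pow, Complex.sub_re, Complex.re_ofReal_mul, Complex.re_ofReal_mul,
      Complex.ofReal_re]
    ring
  rw [h2] at key
  have := nonneg_of_mul_nonneg_right key hpos
  linarith

theorem Matrix.PosDef.det_re_pos {n : Type*} [Fintype n] [DecidableEq n]
    {G : Matrix n n ℂ} (hG : G.PosDef) : 0 < G.det.re :=
  (Complex.lt_def.1 hG.det_pos).1

theorem Matrix.PosDef.det_im_eq_zero {n : Type*} [Fintype n] [DecidableEq n]
    {G : Matrix n n ℂ} (hG : G.PosDef) : G.det.im = 0 :=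
  ((Complex.lt_def.1 hG.det_pos).2).symm

/-- The matrix determinant lemma for a Hermitian rank-one update. It makes the leverage score govern
how the determinant responds to a change of one weight. -/
theorem Matrix.PosDef.det_re_add_smul_vecMulVec {n : Type*} [Fintype n] [DecidableEq n]
    {G : Matrix n n ℂ} (hG : G.PosDef) (t : ℝ) (v : n → ℂ) :
    (G + (t : ℂ) • vecMulVec v (star v)).det.re =
      G.det.re * (1 + t * (star v ⬝ᵥ G⁻¹ *ᵥ v).re) := by
  have hdet : IsUnit G.det := (Matrix.isUnit_iff_isUnit_det _).1 hG.isUnit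
  have h1 : (t : ℂ) • vecMulVec v (star v)
      = replicateCol Unit ((t : ℂ) • v) * replicateRow Unit (star v) := by
    rw [← vecMulVec_eq, smul_vecMulVec]
  rw [h1, det_add_replicateCol_mul_replicateRow hdet]
  have h2 : (1 + replicateRow Unit (star v) * G⁻¹ * replicateCol Unit ((t : ℂ) • v)).det
      = 1 + (t : ℂ) * (star v ⬝ᵥ G⁻¹ *ᵥ v) := by
    rw [det_unique, Matrix.mul_assoc, ← replicateCol_mulVec]
    simp [mulVec_smul]
  rw [h2, Complex.mul_re, hG.det_im_eq_zero, zero_mul, sub_zero, Complex.add_re,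
    Complex.re_ofReal_mul, Complex.one_re]

theorem Matrix.PosDef.re_inv_nonneg {n : Type*} [Fintype n] [DecidableEq n]
    {G : Matrix n n ℂ} (hG : G.PosDef) (v : n → ℂ) : 0 ≤ (star v ⬝ᵥ G⁻¹.mulVec v).re :=
  hG.inv.posSemidef.re_dotProduct_nonneg v

end

/-! ### Weighted moment matrices and leverage scores. -/

section

open Matrix Finset
open scoped ComplexOrder

variable {α : Type*}

/-- The conjugated moment vector `(1, w̄, …, w̄ ^ (h - 1))`. -/
def momentVec (h : ℕ) (w : ℂ) : Fin h → ℂ := fun j => star (w ^ (j : ℕ))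

/-- The Gram matrix of the monomials of degree less than `h` on the points `z p`, `p ∈ J`,
with weights `exp (x p)`. -/
noncomputable def momentGram (h : ℕ) (z : α → ℂ) (J : Finset α) (x : α → ℝ) :
    Matrix (Fin h) (Fin h) ℂ :=
  ∑ p ∈ J, ((Real.exp (x p) : ℝ) : ℂ) •
    vecMulVec (momentVec h (z p)) (star (momentVec h (z p)))

/-- The leverage score of `p` for polynomials of degree less than `h` on the points
`z p`, `p ∈ J`, with weights `exp (x p)`. -/
noncomputable def leverage (h : ℕ) (z : α → ℂ) (J : Finset α) (x : α → ℝ) (p : α) : ℝ :=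
  Real.exp (x p) *
    (star (momentVec h (z p)) ⬝ᵥ (momentGram h z J x)⁻¹ *ᵥ momentVec h (z p)).re

theorem momentGram_quadForm (h : ℕ) (z : α → ℂ) (J : Finset α) (x : α → ℝ) (c : Fin h → ℂ) :
    star c ⬝ᵥ momentGram h z J x *ᵥ c =
      ((∑ p ∈ J, Real.exp (x p) * Complex.normSq (star (momentVec h (z p)) ⬝ᵥ c) : ℝ) : ℂ) := by
  unfold momentGram
  rw [sum_mulVec, dotProduct_sum, Complex.ofReal_sum]
  refine Finset.sum_congr rfl fun p _ => ?_
  rw [smul_mulVec, dotProduct_smul, vecMulVec_mulVec, smul_eq_mul, Complex.ofReal_mul]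
  congr 1
  have : star c ⬝ᵥ momentVec h (z p) = star (star (momentVec h (z p)) ⬝ᵥ c) := by
    rw [← star_dotProduct_star, star_star, dotProduct_comm]
  simp only [dotProduct_smul, MulOpposite.smul_eq_mul_unop, MulOpposite.unop_op, this]
  rw [mul_comm]
  exact Complex.mul_conj _

theorem star_momentVec_dotProduct (h : ℕ) (w : ℂ) (c : Fin h → ℂ) :
    star (momentVec h w) ⬝ᵥ c =
      (∑ j : Fin h, Polynomial.C (c j) * Polynomial.X ^ (j : ℕ)).eval w := by
  rw [Polynomial.eval_finsetSum]
  refine Finset.sum_congr rfl fun j _ => ?_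
  rw [Polynomial.eval_C_mul, Polynomial.eval_X_pow, Pi.star_apply, momentVec, star_star, mul_comm]

theorem exists_star_momentVec_dotProduct {h : ℕ} {Q : Polynomial ℂ} (hQ : Q.degree < h) :
    ∃ c : Fin h → ℂ, ∀ w, star (momentVec h w) ⬝ᵥ c = Q.eval w := by
  refine ⟨fun j => Q.coeff j, fun w => ?_⟩
  rw [star_momentVec_dotProduct]
  congr 1
  rcases eq_or_ne Q 0 with rfl | h0
  · simp
  conv_rhs => rw [Q.as_sum_range_C_mul_X_pow' ((Polynomial.natDegree_lt_iff_degree_lt h0).2 hQ)]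
  rw [Finset.sum_range]

/-- The quadratic form is a weighted `ℓ²` norm of polynomial values, and a polynomial of degree less
than `h` vanishing at `h` distinct points is zero. -/
theorem momentGram_posDef {h : ℕ} {z : α → ℂ} {J : Finset α} (hz : Set.InjOn z J)
    (hJ : h ≤ #J) (x : α → ℝ) : (momentGram h z J x).PosDef := by
  refine PosDef.of_dotProduct_mulVec_pos ?_ ?_
  · refine PosSemidef.isHermitian (posSemidef_sum _ fun p _ => ?_)
    exact (posSemidef_vecMulVec_self_star _).smul (by exact_mod_cast (Real.exp_pos _).le)
  · intro c hc
    rw [momentGram_quadForm]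
    rw [Complex.zero_lt_real]
    have hnn : ∀ p ∈ J, 0 ≤ Real.exp (x p) *
        Complex.normSq (star (momentVec h (z p)) ⬝ᵥ c) := fun p _ =>
      mul_nonneg (Real.exp_pos _).le (Complex.normSq_nonneg _)
    refine (Finset.sum_nonneg hnn).lt_of_ne fun hne => hc ?_
    have hz0 := (Finset.sum_eq_zero_iff_of_nonneg hnn).1 hne.symm
    set Q : Polynomial ℂ := ∑ j : Fin h, Polynomial.C (c j) * Polynomial.X ^ (j : ℕ) with hQ
    have hQdeg : Q.degree < h := by
      rw [hQ, ← Polynomial.mem_degreeLT]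
      refine Submodule.sum_mem _ fun j _ => Polynomial.mem_degreeLT.2 ?_
      exact (Polynomial.degree_C_mul_X_pow_le _ _).trans_lt (by exact_mod_cast j.2)
    have hQ0 : Q = 0 := by
      by_contra hne
      have hd : Q.natDegree < #(J.image z) := by
        rw [Finset.card_image_of_injOn hz]
        exact ((Polynomial.natDegree_lt_iff_degree_lt hne).2 hQdeg).trans_le hJ
      refine hne (Polynomial.eq_zero_of_natDegree_lt_card_of_eval_eq_zero' Q (J.image z) ?_ hd)
      intro w hw
      obtain ⟨p, hp, rfl⟩ := Finset.mem_image.1 hw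
      have := hz0 p hp
      rw [hQ, ← star_momentVec_dotProduct]
      simpa [Real.exp_ne_zero] using this
    funext j
    have : Q.coeff j = c j := by
      rw [hQ, Polynomial.finsetSum_coeff]
      simp only [Polynomial.coeff_C_mul, Polynomial.coeff_X_pow]
      rw [Finset.sum_eq_single j]
      · simp
      · intro b _ hb
        rw [if_neg (fun h => hb (Fin.ext h.symm)), mul_zero]
      · simp
    rw [← this, hQ0]; simp

theorem leverage_nonneg {h : ℕ} {z : α → ℂ} {J : Finset α} (hz : Set.InjOn z J)
    (hJ : h ≤ #J) (x : α → ℝ) (p : α) : 0 ≤ leverage h z J x p :=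
  mul_nonneg (Real.exp_pos _).le ((momentGram_posDef hz hJ x).re_inv_nonneg _)

/-- The variational (Christoffel function) property of leverage scores. -/
theorem exp_mul_normSq_eval_le {h : ℕ} {z : α → ℂ} {J : Finset α} (hz : Set.InjOn z J)
    (hJ : h ≤ #J) (x : α → ℝ) (p : α) {Q : Polynomial ℂ} (hQ : Q.degree < h) :
    Real.exp (x p) * Complex.normSq (Q.eval (z p)) ≤
      leverage h z J x p * ∑ q ∈ J, Real.exp (x q) * Complex.normSq (Q.eval (z q)) := by
  obtain ⟨c, hc⟩ := exists_star_momentVec_dotProduct hQ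
  have := (momentGram_posDef hz hJ x).normSq_dotProduct_le (momentVec h (z p)) c
  rw [momentGram_quadForm, Complex.ofReal_re] at this
  simp only [hc] at this
  rw [leverage, mul_assoc]
  exact mul_le_mul_of_nonneg_left this (Real.exp_pos _).le

theorem momentGram_congr (h : ℕ) (z : α → ℂ) (J : Finset α) {x y : α → ℝ}
    (hxy : ∀ p ∈ J, x p = y p) : momentGram h z J x = momentGram h z J y :=
  Finset.sum_congr rfl fun p hp => by rw [hxy p hp]

/-- With exactly `h` points the Gram matrix factors as `A D Aᴴ` with `A` square and `D` the diagonal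
of weights, so the weights factor out of the determinant. -/
theorem det_momentGram_of_card_eq {h : ℕ} (z : α → ℂ) {J : Finset α} (hJ : #J = h) (x : α → ℝ) :
    (momentGram h z J x).det.re =
      Real.exp (∑ p ∈ J, x p) * (momentGram h z J 0).det.re := by
  have e : Fin h ≃ J := (Finset.equivFinOfCardEq hJ).symm
  set A : Matrix (Fin h) (Fin h) ℂ := Matrix.of fun j i => momentVec h (z (e i)) j with hA
  have key : ∀ y : α → ℝ, momentGram h z J y =
      A * diagonal (fun i => ((Real.exp (y (e i)) : ℝ) : ℂ)) * Aᴴ := by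
    intro y
    ext j k
    rw [momentGram, Matrix.sum_apply, ← Finset.sum_coe_sort, ← e.sum_comp, Matrix.mul_apply]
    refine Finset.sum_congr rfl fun i _ => ?_
    rw [mul_diagonal]
    simp only [Matrix.smul_apply, vecMulVec_apply, Pi.star_apply, smul_eq_mul, hA, of_apply,
      conjTranspose_apply]
    ring
  have key2 : ∀ y : α → ℝ, (momentGram h z J y).det =
      ((Real.exp (∑ p ∈ J, y p) : ℝ) : ℂ) * (A.det * Aᴴ.det) := by
    intro y
    rw [key, det_mul, det_mul, det_diagonal, ← Complex.ofReal_prod, ← Real.exp_sum,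
      e.sum_comp (fun p : J => y p), Finset.sum_coe_sort]
    ring
  have h0 := key2 0
  simp only [Pi.zero_apply, Finset.sum_const_zero, Real.exp_zero, Complex.ofReal_one,
    one_mul] at h0
  rw [key2, ← h0, Complex.re_ofReal_mul]

variable [DecidableEq α]

theorem momentGram_lower {h : ℕ} {z : α → ℂ} {J : Finset α} {p : α} (hp : p ∈ J) (x : α → ℝ) :
    momentGram h z J (Function.update x p (x p - 1)) = momentGram h z J x +
      (((Real.exp (-1) - 1) * Real.exp (x p) : ℝ) : ℂ) •
        vecMulVec (momentVec h (z p)) (star (momentVec h (z p))) := by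
  unfold momentGram
  rw [← Finset.add_sum_erase _ _ hp, ← Finset.add_sum_erase _ _ hp]
  have : ∑ q ∈ J.erase p, ((Real.exp (Function.update x p (x p - 1) q) : ℝ) : ℂ) •
      vecMulVec (momentVec h (z q)) (star (momentVec h (z q))) =
      ∑ q ∈ J.erase p, ((Real.exp (x q) : ℝ) : ℂ) •
      vecMulVec (momentVec h (z q)) (star (momentVec h (z q))) :=
    Finset.sum_congr rfl fun q hq => by
      rw [Function.update_of_ne (Finset.ne_of_mem_erase hq)]
  rw [this, add_right_comm, ← add_smul, Function.update_self]
  congr 2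
  rw [← Complex.ofReal_add]
  congr 1
  rw [sub_eq_add_neg (x p), Real.exp_add]
  ring

/-- Lowering one log-weight is a rank-one update that multiplies the determinant by `1 - (1 - e⁻¹) *
leverage`; then `log t ≤ t - 1`. -/
theorem log_det_momentGram_lower {h : ℕ} {z : α → ℂ} {J : Finset α} (hz : Set.InjOn z J)
    (hJ : h ≤ #J) {p : α} (hp : p ∈ J) (x : α → ℝ) :
    Real.log (momentGram h z J (Function.update x p (x p - 1))).det.re ≤
      Real.log (momentGram h z J x).det.re - (1 - Real.exp (-1)) * leverage h z J x p := by
  have h1 := (momentGram_posDef hz hJ x).det_re_add_smul_vecMulVec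
    ((Real.exp (-1) - 1) * Real.exp (x p)) (momentVec h (z p))
  rw [← momentGram_lower hp] at h1
  have hpos := (momentGram_posDef hz hJ (Function.update x p (x p - 1))).det_re_pos
  have hpos' := (momentGram_posDef hz hJ x).det_re_pos
  rw [h1] at hpos ⊢
  have h2 := pos_of_mul_pos_right hpos hpos'.le
  rw [Real.log_mul hpos'.ne' h2.ne']
  have := Real.log_le_sub_one_of_pos h2
  rw [leverage]
  linarith

theorem det_momentGram_insert_le {h : ℕ} {z : α → ℂ} {J : Finset α} {p : α} (hp : p ∈ J)
    (hz : Set.InjOn z J) (hJ : h ≤ #(J.erase p)) (x : α → ℝ) :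
    (momentGram h z (J.erase p) x).det.re ≤ (momentGram h z J x).det.re := by
  have hz' : Set.InjOn z (J.erase p) := hz.mono (by simp)
  have hpd := momentGram_posDef hz' hJ x
  have h1 : momentGram h z J x = momentGram h z (J.erase p) x + ((Real.exp (x p) : ℝ) : ℂ) •
      vecMulVec (momentVec h (z p)) (star (momentVec h (z p))) := by
    unfold momentGram
    rw [Finset.sum_erase_add _ _ hp]
  rw [h1, hpd.det_re_add_smul_vecMulVec]
  refine le_mul_of_one_le_right hpd.det_re_pos.le ?_
  have := mul_nonneg (Real.exp_pos (x p)).le (hpd.re_inv_nonneg (momentVec h (z p)))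
  linarith

/-- Induction on the number of points: deleting the lightest one does not increase the determinant
and does not lower the average log-weight, until `h` points remain and the determinant is explicit.
The slope `h / #J` is what bounds the balancing functional from below. -/
theorem exists_le_log_det_momentGram {h : ℕ} (z : α → ℂ) (J : Finset α) (hz : Set.InjOn z J)
    (hJ : h ≤ #J) :
    ∃ C : ℝ, ∀ x : α → ℝ, (h : ℝ) / #J * ∑ p ∈ J, x p - C ≤
      Real.log (momentGram h z J x).det.re := by
  obtain ⟨k, hk⟩ := Nat.exists_eq_add_of_le hJ
  induction k generalizing J with
  | zero =>
    refine ⟨-Real.log (momentGram h z J 0).det.re, fun x => ?_⟩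
    have hh : (h : ℝ) / #J * ∑ p ∈ J, x p = ∑ p ∈ J, x p := by
      rcases Nat.eq_zero_or_pos h with h0 | h0
      · have : J = ∅ := Finset.card_eq_zero.1 (by omega)
        simp [this]
      · rw [hk, add_zero, div_self (by positivity), one_mul]
    rw [det_momentGram_of_card_eq z (by omega) x, hh, Real.log_mul (Real.exp_ne_zero _)
      (momentGram_posDef hz hJ 0).det_re_pos.ne', Real.log_exp]
    linarith
  | succ k ih =>
    have hcard : ∀ p ∈ J, #(J.erase p) = h + k := fun p hp => by
      rw [Finset.card_erase_of_mem hp]; omega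
    have hz' : ∀ p, Set.InjOn z (J.erase p) := fun p =>
      hz.mono (by simp)
    have : ∀ p, ∃ C : ℝ, p ∈ J → ∀ x : α → ℝ,
        (h : ℝ) / #(J.erase p) * ∑ q ∈ J.erase p, x q - C ≤
          Real.log (momentGram h z (J.erase p) x).det.re := by
      intro p
      by_cases hp : p ∈ J
      · obtain ⟨C, hC⟩ := ih (J.erase p) (hz' p) (by rw [hcard p hp]; omega) (hcard p hp)
        exact ⟨C, fun _ => hC⟩
      · exact ⟨0, fun h => absurd h hp⟩
    choose C hC using this
    -- The deleted point depends on `x`, so the constant has to dominate all the `C p` at once.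
    refine ⟨∑ p ∈ J, |C p|, fun x => ?_⟩
    obtain ⟨p, hp, hmin⟩ := Finset.exists_min_image J x (Finset.card_pos.1 (by omega))
    have hle : h ≤ #(J.erase p) := by rw [hcard p hp]; omega
    refine le_trans ?_ (Real.log_le_log (momentGram_posDef (hz' p) hle x).det_re_pos
      (det_momentGram_insert_le hp hz hle x))
    refine le_trans ?_ (hC p hp x)
    have h1 : C p ≤ ∑ p ∈ J, |C p| :=
      (le_abs_self _).trans (Finset.single_le_sum (f := fun p => |C p|)
        (fun _ _ => abs_nonneg _) hp)
    have h2 : (h : ℝ) / #J * ∑ p ∈ J, x p ≤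
        (h : ℝ) / #(J.erase p) * ∑ q ∈ J.erase p, x q := by
      rcases Nat.eq_zero_or_pos h with h0 | h0
      · simp [h0]
      rw [← Finset.add_sum_erase _ _ hp, hcard p hp, hk]
      have h3 : (#(J.erase p) : ℝ) * x p ≤ ∑ q ∈ J.erase p, x q := by
        rw [← nsmul_eq_mul]
        exact Finset.card_nsmul_le_sum _ _ _ fun q hq => hmin q (Finset.mem_of_mem_erase hq)
      rw [hcard p hp] at h3
      have hpos : (0 : ℝ) < h := by exact_mod_cast h0
      push_cast at h3 ⊢
      rw [div_mul_eq_mul_div, div_mul_eq_mul_div, div_le_div_iff₀ (by positivity) (by positivity)]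
      nlinarith
    linarith

end

/-! ### Balanced weights and the rank bound. -/

section

open Finset

variable {α ι : Type*} [DecidableEq α]

/-- There are weights for which the average leverage of every point is, up to a factor `2`, at
most the average over its incident blocks. -/
theorem exists_balanced_weights {h : ℕ} (hh : 1 ≤ h) (I : Finset ι) (L : ι → Finset α)
    (z : ι → α → ℂ) (hz : ∀ i ∈ I, Set.InjOn (z i) (L i)) (hL : ∀ i ∈ I, h ≤ #(L i)) :
    ∃ x : α → ℝ, ∀ p, ∑ i ∈ I with p ∈ L i, (#(L i) : ℝ) ^ 2 * leverage h (z i) (L i) x p ≤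
      2 * h * ∑ i ∈ I with p ∈ L i, (#(L i) : ℝ) := by
  -- The derivative of log det in `x p` is the leverage of `p`, so stationarity of `F` would be
  -- exact balance. The factor `(#L)²` turns the slope `h / #L` of the lower bound into `#L * h`,
  -- which cancels the linear term.
  set F : (α → ℝ) → ℝ := fun x => ∑ i ∈ I,
    ((#(L i) : ℝ) ^ 2 * Real.log (momentGram h (z i) (L i) x).det.re -
      #(L i) * h * ∑ p ∈ L i, x p) with hF
  have hbdd : BddBelow (Set.range F) := by
    have : ∀ i, ∃ C : ℝ, i ∈ I → ∀ x : α → ℝ, (h : ℝ) / #(L i) * ∑ p ∈ L i, x p - C ≤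
        Real.log (momentGram h (z i) (L i) x).det.re := by
      intro i
      by_cases hi : i ∈ I
      · obtain ⟨C, hC⟩ := exists_le_log_det_momentGram (z i) (L i) (hz i hi) (hL i hi)
        exact ⟨C, fun _ => hC⟩
      · exact ⟨0, fun h => absurd h hi⟩
    choose C hC using this
    refine ⟨∑ i ∈ I, -((#(L i) : ℝ) ^ 2 * C i), ?_⟩
    rintro _ ⟨x, rfl⟩
    refine Finset.sum_le_sum fun i hi => ?_
    have h1 := mul_le_mul_of_nonneg_left (hC i hi x) (sq_nonneg (#(L i) : ℝ))
    have hpos : (0 : ℝ) < #(L i) := by exact_mod_cast hh.trans (hL i hi)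
    have h2 : (#(L i) : ℝ) ^ 2 * ((h : ℝ) / #(L i) * ∑ p ∈ L i, x p - C i) =
        #(L i) * h * ∑ p ∈ L i, x p - (#(L i) : ℝ) ^ 2 * C i := by
      field_simp
    linarith
  -- The infimum need not be attained: a point within `1/4` of it, tested against a unit decrease of
  -- one coordinate, suffices.
  obtain ⟨_, ⟨x, rfl⟩, hx⟩ := Real.lt_sInf_add_pos (Set.range_nonempty F)
    (show (0 : ℝ) < 1 / 4 by norm_num)
  refine ⟨x, fun p => ?_⟩
  set y := Function.update x p (x p - 1) with hy
  have hinf : sInf (Set.range F) ≤ F y := csInf_le hbdd ⟨y, rfl⟩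
  set T := ∑ i ∈ I with p ∈ L i, (#(L i) : ℝ) ^ 2 * leverage h (z i) (L i) x p with hT
  set S := ∑ i ∈ I with p ∈ L i, (#(L i) : ℝ) with hS
  have hstep : F y ≤ F x - (1 - Real.exp (-1)) * T + h * S := by
    rw [hT, hS, Finset.sum_filter, Finset.sum_filter, Finset.mul_sum, Finset.mul_sum, hF]
    simp only
    rw [← Finset.sum_sub_distrib, ← Finset.sum_add_distrib]
    refine Finset.sum_le_sum fun i hi => ?_
    split_ifs with hp
    · have h1 := log_det_momentGram_lower (hz i hi) (hL i hi) hp x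
      have h2 := mul_le_mul_of_nonneg_left h1 (sq_nonneg (#(L i) : ℝ))
      have h3 : ∑ q ∈ L i, y q = ∑ q ∈ L i, x q - 1 := by
        rw [← Finset.add_sum_erase _ _ hp, ← Finset.add_sum_erase _ x hp, hy,
          Function.update_self]
        have : ∑ q ∈ (L i).erase p, Function.update x p (x p - 1) q =
            ∑ q ∈ (L i).erase p, x q := Finset.sum_congr rfl fun q hq => by
          rw [Function.update_of_ne (Finset.ne_of_mem_erase hq)]
        rw [this]
        ring
      rw [h3]
      linarith
    · have hxy : ∀ q ∈ L i, y q = x q := fun q hq => by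
        rw [hy, Function.update_of_ne (ne_of_mem_of_not_mem hq hp)]
      rw [momentGram_congr h (z i) (L i) hxy, Finset.sum_congr rfl hxy]
      simp
  have hmain : (1 - Real.exp (-1)) * T ≤ h * S + 1 / 4 := by linarith
  have hT0 : 0 ≤ T := Finset.sum_nonneg fun i hi => mul_nonneg (sq_nonneg _)
    (leverage_nonneg (hz i (Finset.mem_filter.1 hi).1) (hL i (Finset.mem_filter.1 hi).1) x p)
  rcases (I.filter fun i => p ∈ L i).eq_empty_or_nonempty with he | ⟨i, hi⟩
  · rw [hT, hS, he]; simp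
  · have hi' := Finset.mem_filter.1 hi
    have h1 : (#(L i) : ℝ) ≤ S :=
      Finset.single_le_sum (f := fun i => (#(L i) : ℝ)) (fun _ _ => Nat.cast_nonneg _) hi
    have h2 : (1 : ℝ) ≤ #(L i) := by exact_mod_cast hh.trans (hL i hi'.1)
    have h3 : (1 : ℝ) ≤ h := by exact_mod_cast hh
    have h4 : 1 ≤ h * S := by nlinarith
    -- Now `(5/8) T ≤ h S + 1/4 ≤ (5/4) h S`, which is the factor `2`.
    have h5 : Real.exp (-1) < 3 / 8 := lt_trans Real.exp_neg_one_lt_d9 (by norm_num)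
    nlinarith

/-- If a vector of norm square at most `K` takes the value `K` at `p`, and on each of several
blocks meeting only at `p` its value at `p` is controlled by a leverage score, then `K` is small. -/
theorem mul_sum_card_le_of_leverage_bound {h : ℕ} (hh : 1 ≤ h) [Fintype α]
    (I : Finset ι) (L : ι → Finset α) {p : α} (hp : ∀ i ∈ I, p ∈ L i)
    (hL : ∀ i ∈ I, 4 * h ≤ #(L i))
    (hdisj : ∀ i ∈ I, ∀ j ∈ I, i ≠ j → ∀ q ∈ L i, q ∈ L j → q = p)
    (w : α → ℝ) (hw : ∀ q, 0 ≤ w q) {K : ℝ} (hwp : w p = K ^ 2) (hwK : ∑ q, w q = K)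
    (τ : ι → ℝ) (hτ0 : ∀ i ∈ I, 0 ≤ τ i) (hτ : ∀ i ∈ I, K ^ 2 ≤ τ i * ∑ q ∈ L i, w q)
    (hbal : ∑ i ∈ I, (#(L i) : ℝ) ^ 2 * τ i ≤ 2 * h * ∑ i ∈ I, (#(L i) : ℝ)) :
    K * ∑ i ∈ I, (#(L i) : ℝ) ≤ 4 * h := by
  have hK0 : 0 ≤ K := hwK ▸ Finset.sum_nonneg fun q _ => hw q
  have hhr : (1 : ℝ) ≤ h := by exact_mod_cast hh
  rcases hK0.eq_or_lt with hK | hK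
  · rw [← hK, zero_mul]; positivity
  -- The blocks are disjoint away from `p`, so their masses there add up to at most the total.
  have hsum : ∑ i ∈ I, ∑ q ∈ (L i).erase p, w q ≤ K := by
    rw [← Finset.sum_biUnion, ← hwK]
    · exact Finset.sum_le_sum_of_subset_of_nonneg (Finset.subset_univ _) fun q _ _ => hw q
    · intro i hi j hj hij
      refine Finset.disjoint_left.2 fun q hqi hqj => ?_
      exact Finset.ne_of_mem_erase hqi (hdisj i hi j hj hij q (Finset.mem_of_mem_erase hqi)
        (Finset.mem_of_mem_erase hqj))
  have hone : ∀ i ∈ I, K ^ 2 * ((#(L i) : ℝ) * (3 / (4 * h)) -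
      (#(L i) : ℝ) ^ 2 * τ i * (1 / (4 * h ^ 2))) ≤ ∑ q ∈ (L i).erase p, w q := by
    intro i hi
    have h1 := hτ i hi
    rw [← Finset.add_sum_erase _ _ (hp i hi), hwp] at h1
    set A := ∑ q ∈ (L i).erase p, w q
    have hA : 0 ≤ A := Finset.sum_nonneg fun q _ => hw q
    have hs : (4 * h : ℝ) ≤ #(L i) := by exact_mod_cast hL i hi
    have hτpos : 0 < τ i := by
      rcases (hτ0 i hi).eq_or_lt with h0 | h0
      · rw [← h0, zero_mul] at h1
        exact absurd h1 (not_le.2 (by positivity))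
      · exact h0
    -- The mass of the block is at least `K² / τ`, and `1/τ ≥ 2a - a²τ` is the tangent line at `τ =
    -- 1/a = 2h / #L`, the value allowed by `hbal` on average. Being linear in `τ`, it can be summed
    -- against `hbal`. Size at least `4h` gives `a ≥ 2`, so removing the mass `K²` of `p` costs at
    -- most `K² a / 2`.
    set a : ℝ := #(L i) / (2 * h) with ha
    have e1 : (#(L i) : ℝ) * (3 / (4 * h)) = 3 / 2 * a := by rw [ha]; field_simp; norm_num
    have e2 : (#(L i) : ℝ) ^ 2 * τ i * (1 / (4 * h ^ 2)) = a ^ 2 * τ i := by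
      rw [ha]; field_simp; norm_num
    rw [e1, e2]
    have ha2 : 2 ≤ a := by rw [ha, le_div_iff₀ (by positivity)]; linarith
    have h3 : K ^ 2 * (2 * a - a ^ 2 * τ i) ≤ K ^ 2 + A := by
      refine le_of_mul_le_mul_left ?_ hτpos
      refine le_trans ?_ h1
      nlinarith [mul_nonneg (sq_nonneg K) (sq_nonneg (1 - a * τ i))]
    nlinarith [sq_nonneg K, mul_nonneg (sq_nonneg K) (sub_nonneg.2 ha2)]
  have htot := (Finset.sum_le_sum hone).trans hsum
  rw [← Finset.mul_sum, Finset.sum_sub_distrib, ← Finset.sum_mul, ← Finset.sum_mul] at htot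
  set S := ∑ i ∈ I, (#(L i) : ℝ)
  have h5 : S / (4 * h) ≤ S * (3 / (4 * h)) -
      (∑ i ∈ I, (#(L i) : ℝ) ^ 2 * τ i) * (1 / (4 * h ^ 2)) := by
    have : (∑ i ∈ I, (#(L i) : ℝ) ^ 2 * τ i) * (1 / (4 * h ^ 2)) ≤
        2 * h * S * (1 / (4 * h ^ 2)) := mul_le_mul_of_nonneg_right hbal (by positivity)
    have e : 2 * h * S * (1 / (4 * h ^ 2)) = S * (3 / (4 * h)) - S / (4 * h) := by
      field_simp; ring
    linarith
  have h6 : K ^ 2 * (S / (4 * h)) ≤ K :=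
    (mul_le_mul_of_nonneg_left h5 (sq_nonneg K)).trans htot
  have h7 : K * (S / (4 * h)) ≤ 1 := by
    refine le_of_mul_le_mul_left ?_ hK
    linarith
  rw [← mul_div_assoc, div_le_one (by positivity)] at h7
  exact h7

open scoped ComplexConjugate in
/-- A rank bound: functions restricting to polynomials of degree less than `h` on blocks of size at
least `4 * h`, any two blocks having at most one common point, form a space of dimension at most
`4 * h * |α| / κ` when the blocks through each point have total size at least `κ`. -/
theorem finrank_mul_le_of_blocks [Fintype α] {h : ℕ} (hh : 1 ≤ h) (I : Finset ι)
    (L : ι → Finset α) (z : ι → α → ℂ) (hz : ∀ i ∈ I, Set.InjOn (z i) (L i))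
    (hL : ∀ i ∈ I, 4 * h ≤ #(L i))
    (hdisj : ∀ i ∈ I, ∀ j ∈ I, i ≠ j → ∀ p q, p ∈ L i → p ∈ L j → q ∈ L i → q ∈ L j → q = p)
    {κ : ℝ} (hκ : ∀ p, κ ≤ ∑ i ∈ I with p ∈ L i, (#(L i) : ℝ)) (U : Submodule ℂ (α → ℂ))
    (hU : ∀ u ∈ U, ∀ i ∈ I, ∃ Q : Polynomial ℂ, Q.degree < h ∧
      ∀ p ∈ L i, u p = Q.eval (z i p)) :
    (Module.finrank ℂ U : ℝ) * κ ≤ 4 * h * Fintype.card α := by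
  have hL' : ∀ i ∈ I, h ≤ #(L i) := fun i hi => by have := hL i hi; omega
  obtain ⟨x, hx⟩ := exists_balanced_weights hh I L z hz hL'
  -- Scaling by square roots of the weights turns the weighted norm into the Euclidean one.
  let e₁ : (α → ℂ) ≃ₗ[ℂ] (α → ℂ) := LinearEquiv.piCongrRight fun p =>
    LinearEquiv.smulOfNeZero ℂ ℂ ((Real.exp (x p / 2) : ℝ) : ℂ)
      (by exact_mod_cast Real.exp_ne_zero _)
  let e : (α → ℂ) ≃ₗ[ℂ] EuclideanSpace ℂ α := e₁.trans (WithLp.linearEquiv 2 ℂ (α → ℂ)).symm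
  have he : ∀ u p, e u p = ((Real.exp (x p / 2) : ℝ) : ℂ) * u p := fun u p => rfl
  set U' : Submodule ℂ (EuclideanSpace ℂ α) := U.map (e : (α → ℂ) →ₗ[ℂ] EuclideanSpace ℂ α)
    with hU'
  have hfin : Module.finrank ℂ U' = Module.finrank ℂ U := LinearEquiv.finrank_map_eq e U
  set b := stdOrthonormalBasis ℂ U' with hb
  -- `K p` is the diagonal entry at `p` of the orthogonal projection onto `U'`; the trace is the
  -- dimension.
  set K : α → ℝ := fun p => ∑ j, ‖(b j : EuclideanSpace ℂ α) p‖ ^ 2 with hK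
  have hKsum : ∑ p, K p = Module.finrank ℂ U := by
    rw [hK, Finset.sum_comm]
    have : ∀ j, ∑ p, ‖(b j : EuclideanSpace ℂ α) p‖ ^ 2 = 1 := fun j => by
      rw [← EuclideanSpace.norm_sq_eq]
      have := b.orthonormal.1 j
      rw [Submodule.coe_norm] at this
      rw [this, one_pow]
    simp [this, hfin]
  have hKp : ∀ p, K p * κ ≤ 4 * h := by
    intro p
    have hKnn : 0 ≤ K p := Finset.sum_nonneg fun j _ => sq_nonneg _
    refine (mul_le_mul_of_nonneg_left (hκ p) hKnn).trans ?_
    -- The reproducing kernel at `p`: its value at `p` and its squared norm are both `K p`.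
    set g : U' := ∑ j, conj ((b j : EuclideanSpace ℂ α) p) • b j with hg
    have hgp : (g : EuclideanSpace ℂ α) p = (K p : ℂ) := by
      rw [hg, hK]
      simp only [Submodule.coe_sum, Submodule.coe_smul, WithLp.ofLp_sum, WithLp.ofLp_smul,
        Finset.sum_apply, Pi.smul_apply, smul_eq_mul, Complex.ofReal_sum]
      exact Finset.sum_congr rfl fun j _ => by
        rw [Complex.conj_mul', Complex.ofReal_pow]
    have hgn : ∑ q, ‖(g : EuclideanSpace ℂ α) q‖ ^ 2 = K p := by
      rw [← EuclideanSpace.norm_sq_eq, ← Submodule.coe_norm, ← b.sum_sq_norm_inner_right g, hK]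
      refine Finset.sum_congr rfl fun j _ => ?_
      rw [hg, b.orthonormal.inner_right_fintype, RCLike.norm_conj]
    obtain ⟨u, huU, hu⟩ : ∃ u ∈ U, e u = g := g.2
    have hgu : ∀ q, ‖(g : EuclideanSpace ℂ α) q‖ ^ 2 = Real.exp (x q) * Complex.normSq (u q) := by
      intro q
      rw [← hu, he, norm_mul, mul_pow, Complex.normSq_eq_norm_sq]
      congr 1
      rw [Complex.norm_real, Real.norm_eq_abs, sq_abs, ← Real.exp_nat_mul]
      congr 1; push_cast; ring
    refine mul_sum_card_le_of_leverage_bound hh (I.filter fun i => p ∈ L i) L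
      (fun i hi => (Finset.mem_filter.1 hi).2) (fun i hi => hL i (Finset.mem_filter.1 hi).1)
      ?_ (fun q => ‖(g : EuclideanSpace ℂ α) q‖ ^ 2) (fun q => sq_nonneg _) ?_ hgn
      (fun i => leverage h (z i) (L i) x p) ?_ ?_ (hx p)
    · intro i hi j hj hij q hqi hqj
      rw [Finset.mem_filter] at hi hj
      exact hdisj i hi.1 j hj.1 hij p q hi.2 hj.2 hqi hqj
    · simp only [hgp]
      rw [Complex.norm_real, Real.norm_eq_abs, sq_abs]
    · intro i hi
      rw [Finset.mem_filter] at hi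
      exact leverage_nonneg (hz i hi.1) (hL' i hi.1) x p
    · intro i hi
      rw [Finset.mem_filter] at hi
      obtain ⟨Q, hQ, hQu⟩ := hU u huU i hi.1
      have h1 := exp_mul_normSq_eval_le (hz i hi.1) (hL' i hi.1) x p hQ
      have h2 : K p ^ 2 = Real.exp (x p) * Complex.normSq (Q.eval (z i p)) := by
        rw [← hQu p hi.2, ← hgu, hgp, Complex.norm_real, Real.norm_eq_abs, sq_abs]
      rw [h2]
      refine h1.trans_eq ?_
      congr 1
      exact Finset.sum_congr rfl fun q hq => by rw [hgu, hQu q hq]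
  rw [← hKsum, Finset.sum_mul]
  refine (Finset.sum_le_sum fun p _ => hKp p).trans_eq ?_
  rw [Finset.sum_const, nsmul_eq_mul, Finset.card_univ]
  ring

end

/-! ### Counting progressions by lines, and pruning. -/

section

open Finset

/-- The number of points of `l` between `p` (included) and `q` (excluded) in the order of `f`. -/
noncomputable def orderGap {E : Type*} (f : E → ℝ) (l : Finset E) (p q : E) : ℕ := by
  classical exact #{v ∈ l | f p ≤ f v ∧ f v < f q}

/-- The gap from `p` is strictly increasing in the later endpoint and at least `1`, so it injects
these points into `[1, B]`. -/
theorem card_filter_orderGap_le {E : Type*} {f : E → ℝ} {l : Finset E} (hf : Set.InjOn f l)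
    {p : E} (hp : p ∈ l) (B : ℕ) [DecidablePred fun q => f p < f q ∧ orderGap f l p q ≤ B] :
    #{q ∈ l | f p < f q ∧ orderGap f l p q ≤ B} ≤ B := by
  classical
  have key : ∀ q ∈ l, ∀ q' ∈ l, f p < f q → f q < f q' →
      orderGap f l p q < orderGap f l p q' := by
    intro q hq q' hq' h1 h2
    unfold orderGap
    refine Finset.card_lt_card (Finset.ssubset_iff_subset_ne.2 ⟨?_, fun h => ?_⟩)
    · intro v hv
      rw [Finset.mem_filter] at hv ⊢
      exact ⟨hv.1, hv.2.1, hv.2.2.trans h2⟩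
    · have : q ∈ ({v ∈ l | f p ≤ f v ∧ f v < f q} : Finset E) := by
        rw [h, Finset.mem_filter]; exact ⟨hq, h1.le, h2⟩
      exact lt_irrefl _ (Finset.mem_filter.1 this).2.2
  have := Finset.card_le_card_of_injOn (s := {q ∈ l | f p < f q ∧ orderGap f l p q ≤ B})
    (t := Finset.Icc 1 B) (fun q => orderGap f l p q) ?_ ?_
  · simpa using this
  · intro q hq
    have hq := Finset.mem_filter.1 hq
    refine Finset.mem_coe.2 (Finset.mem_Icc.2 ⟨?_, hq.2.2⟩)
    exact Finset.card_pos.2 ⟨p, Finset.mem_filter.2 ⟨hp, le_rfl, hq.2.1⟩⟩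
  · intro q hq q' hq' h
    have hq := Finset.mem_filter.1 hq
    have hq' := Finset.mem_filter.1 hq'
    rcases lt_trichotomy (f q) (f q') with hlt | heq | hlt
    · exact absurd h (key q hq.1 q' hq'.1 hq.2.1 hlt).ne
    · exact hf hq.1 hq'.1 heq
    · exact absurd h (key q' hq'.1 q hq.1 hq'.2.1 hlt).ne'

/-- In a monotone chain of `r` points of `l`, at least half of the steps skip few points. -/
theorem le_two_mul_card_short_steps {E : Type*} {f : E → ℝ} {l : Finset E} {r : ℕ} (hr : 2 ≤ r)
    {a : ℕ → E} (ha : ∀ k < r, a k ∈ l) (hmono : StrictMono fun k => f (a k)) :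
    r - 1 ≤ 2 * #{k ∈ range (r - 1) | orderGap f l (a k) (a (k + 1)) ≤ 2 * #l / (r - 1)} := by
  classical
  have hl : 0 < #l := Finset.card_pos.2 ⟨a 0, ha 0 (by omega)⟩
  -- Consecutive half-open intervals are disjoint, so the gaps sum to at most `#l`; Markov's
  -- inequality then bounds the number of long steps.
  have hsum : ∑ k ∈ range (r - 1), orderGap f l (a k) (a (k + 1)) ≤ #l := by
    unfold orderGap
    rw [← Finset.card_biUnion]
    · exact Finset.card_le_card (Finset.biUnion_subset.2 fun k _ => Finset.filter_subset _ _)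
    · have aux : ∀ i j : ℕ, i < j → Disjoint
          ({v ∈ l | f (a i) ≤ f v ∧ f v < f (a (i + 1))} : Finset E)
          ({v ∈ l | f (a j) ≤ f v ∧ f v < f (a (j + 1))} : Finset E) := by
        intro i j hij
        refine Finset.disjoint_left.2 fun v hi hj => ?_
        have hi := (Finset.mem_filter.1 hi).2.2
        have hj := (Finset.mem_filter.1 hj).2.1
        have := hmono.monotone (show i + 1 ≤ j by omega)
        exact absurd (hi.trans_le (this.trans hj)) (lt_irrefl _)
      intro i _ j _ hij
      rcases lt_or_gt_of_ne hij with h | h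
      · exact aux i j h
      · exact (aux j i h).symm
  set good := {k ∈ range (r - 1) | orderGap f l (a k) (a (k + 1)) ≤ 2 * #l / (r - 1)}
  set bad := {k ∈ range (r - 1) | ¬ orderGap f l (a k) (a (k + 1)) ≤ 2 * #l / (r - 1)} with hbad
  have hcard : #good + #bad = r - 1 := by
    rw [Finset.card_filter_add_card_filter_not, Finset.card_range]
  have hb : #bad * (2 * #l) ≤ #l * (r - 1) := by
    calc #bad * (2 * #l) = ∑ k ∈ bad, 2 * #l := by rw [Finset.sum_const, smul_eq_mul]
      _ ≤ ∑ k ∈ bad, orderGap f l (a k) (a (k + 1)) * (r - 1) := by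
          refine Finset.sum_le_sum fun k hk => ?_
          have := (Finset.mem_filter.1 hk).2
          rw [Nat.le_div_iff_mul_le (by omega)] at this
          omega
      _ = (∑ k ∈ bad, orderGap f l (a k) (a (k + 1))) * (r - 1) := by rw [Finset.sum_mul]
      _ ≤ #l * (r - 1) := by
          refine Nat.mul_le_mul_right _ (le_trans ?_ hsum)
          exact Finset.sum_le_sum_of_subset (Finset.filter_subset _ _)
  have : #bad * 2 ≤ r - 1 := by
    refine Nat.le_of_mul_le_mul_left ?_ hl
    linarith
  omega

variable {E : Type*} [AddCommGroup E] [Module ℂ E]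

open Classical in
/-- The points of `V` on the line through `p` and `q`. -/
noncomputable def lineThrough (V : Finset E) (p q : E) : Finset E :=
  {v ∈ V | ∃ w : ℂ, v = p + w • (q - p)}

open Classical in
/-- The maximal collinear subsets of `V` with at least two points. -/
noncomputable def lineSets (V : Finset E) : Finset (Finset E) :=
  V.offDiag.image fun a => lineThrough V a.1 a.2

theorem mem_lineThrough {V : Finset E} {p q v : E} :
    v ∈ lineThrough V p q ↔ v ∈ V ∧ ∃ w : ℂ, v = p + w • (q - p) := by
  simp [lineThrough]

theorem lineThrough_eq {V : Finset E} {p q v w : E} (hv : v ∈ lineThrough V p q)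
    (hw : w ∈ lineThrough V p q) (hvw : v ≠ w) : lineThrough V v w = lineThrough V p q := by
  obtain ⟨-, s, hs⟩ := mem_lineThrough.1 hv
  obtain ⟨-, t, ht⟩ := mem_lineThrough.1 hw
  have hst : t - s ≠ 0 := fun h => hvw (by rw [hs, ht, sub_eq_zero.1 h])
  have hd : w - v = (t - s) • (q - p) := by rw [hs, ht, sub_smul]; abel
  ext u
  rw [mem_lineThrough, mem_lineThrough]
  refine and_congr_right fun _ => ⟨?_, ?_⟩
  · rintro ⟨c, rfl⟩
    refine ⟨s + c * (t - s), ?_⟩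
    rw [hd, hs, add_smul, mul_smul, add_assoc]
  · rintro ⟨c, rfl⟩
    refine ⟨(c - s) / (t - s), ?_⟩
    rw [hd, smul_smul, div_mul_cancel₀ _ hst, hs, sub_smul]
    abel

theorem lineThrough_mem_lineSets {V : Finset E} {p q : E} (hp : p ∈ V) (hq : q ∈ V)
    (hpq : p ≠ q) : lineThrough V p q ∈ lineSets V := by
  classical
  exact Finset.mem_image.2 ⟨(p, q), Finset.mem_offDiag.2 ⟨hp, hq, hpq⟩, rfl⟩

theorem subset_of_mem_lineSets {V l : Finset E} (hl : l ∈ lineSets V) : l ⊆ V := by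
  classical
  obtain ⟨a, -, rfl⟩ := Finset.mem_image.1 hl
  exact Finset.filter_subset _ _

theorem eq_of_mem_lineSets {V l l' : Finset E} (hl : l ∈ lineSets V) (hl' : l' ∈ lineSets V)
    (hne : l ≠ l') {p q : E} (hp : p ∈ l) (hp' : p ∈ l') (hq : q ∈ l) (hq' : q ∈ l') :
    q = p := by
  classical
  obtain ⟨a, -, rfl⟩ := Finset.mem_image.1 hl
  obtain ⟨b, -, rfl⟩ := Finset.mem_image.1 hl'
  by_contra h
  exact hne ((lineThrough_eq hq hp h).symm.trans (lineThrough_eq hq' hp' h))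

theorem exists_param_of_mem_lineSets {V l : Finset E} (hl : l ∈ lineSets V) :
    ∃ (y x : E) (z : E → ℂ), ∀ v ∈ l, v = y + z v • x := by
  classical
  obtain ⟨a, -, rfl⟩ := Finset.mem_image.1 hl
  have : ∀ v, ∃ c : ℂ, v ∈ lineThrough V a.1 a.2 → v = a.1 + c • (a.2 - a.1) := fun v => by
    by_cases hv : v ∈ lineThrough V a.1 a.2
    · obtain ⟨-, c, hc⟩ := mem_lineThrough.1 hv
      exact ⟨c, fun _ => hc⟩
    · exact ⟨0, fun h => absurd h hv⟩
  choose z hz using this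
  exact ⟨a.1, a.2 - a.1, z, hz⟩

/-- Group the pairs by their line `l`: each first point has at most `2 * #l / (r - 1)` partners
within a short gap. -/
theorem card_filter_orderGap_mul_le {V : Finset E} {f : E → ℝ} (hf : Set.InjOn f V) (r : ℕ)
    [DecidablePred fun a : E × E => r ≤ #(lineThrough V a.1 a.2) ∧ f a.1 < f a.2 ∧
      orderGap f (lineThrough V a.1 a.2) a.1 a.2 ≤ 2 * #(lineThrough V a.1 a.2) / (r - 1)] :
    #{a ∈ V.offDiag | r ≤ #(lineThrough V a.1 a.2) ∧ f a.1 < f a.2 ∧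
      orderGap f (lineThrough V a.1 a.2) a.1 a.2 ≤ 2 * #(lineThrough V a.1 a.2) / (r - 1)} *
        (r - 1) ≤ 2 * ∑ l ∈ lineSets V with r ≤ #l, #l ^ 2 := by
  classical
  have hsub : {a ∈ V.offDiag | r ≤ #(lineThrough V a.1 a.2) ∧ f a.1 < f a.2 ∧
      orderGap f (lineThrough V a.1 a.2) a.1 a.2 ≤ 2 * #(lineThrough V a.1 a.2) / (r - 1)} ⊆
      ((lineSets V).filter fun l => r ≤ #l).biUnion fun l => l.biUnion fun p =>
        ({q ∈ l | f p < f q ∧ orderGap f l p q ≤ 2 * #l / (r - 1)}).image fun q => (p, q) := by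
    rintro ⟨p, q⟩ ha
    rw [Finset.mem_filter, Finset.mem_offDiag] at ha
    obtain ⟨⟨hp, hq, hpq⟩, h1, h2, h3⟩ := ha
    have hpl : p ∈ lineThrough V p q := mem_lineThrough.2 ⟨hp, 0, by simp⟩
    have hql : q ∈ lineThrough V p q := mem_lineThrough.2 ⟨hq, 1, by simp⟩
    refine Finset.mem_biUnion.2 ⟨lineThrough V p q,
      Finset.mem_filter.2 ⟨lineThrough_mem_lineSets hp hq hpq, h1⟩, ?_⟩
    exact Finset.mem_biUnion.2 ⟨p, hpl, Finset.mem_image.2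
      ⟨q, Finset.mem_filter.2 ⟨hql, h2, h3⟩, rfl⟩⟩
  refine (Nat.mul_le_mul_right _ (Finset.card_le_card hsub)).trans ?_
  refine (Nat.mul_le_mul_right _ Finset.card_biUnion_le).trans ?_
  rw [Finset.sum_mul, Finset.mul_sum]
  refine Finset.sum_le_sum fun l hl => ?_
  have hl := (Finset.mem_filter.1 hl).1
  have h1 : #(l.biUnion fun p =>
      ({q ∈ l | f p < f q ∧ orderGap f l p q ≤ 2 * #l / (r - 1)}).image fun q => (p, q)) ≤
      ∑ p ∈ l, 2 * #l / (r - 1) := by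
    refine Finset.card_biUnion_le.trans (Finset.sum_le_sum fun p hp => ?_)
    refine Finset.card_image_le.trans (card_filter_orderGap_le ?_ hp _)
    exact hf.mono (by exact_mod_cast subset_of_mem_lineSets hl)
  refine (Nat.mul_le_mul_right _ h1).trans ?_
  rw [Finset.sum_const, smul_eq_mul, mul_assoc]
  have h2 : 2 * #l / (r - 1) * (r - 1) ≤ 2 * #l := Nat.div_mul_le_self _ _
  calc #l * (2 * #l / (r - 1) * (r - 1)) ≤ #l * (2 * #l) := Nat.mul_le_mul_left _ h2
    _ = 2 * #l ^ 2 := by ring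

/-- An arithmetic progression can be oriented so that a given functional increases along it. -/
theorem IsTermAP.exists_increasing {d r : ℕ} (hr : 2 ≤ r) {P V : Finset (Fin d → ℂ)}
    (hP : IsTermAP r P) (hPV : P ⊆ V) (f : (Fin d → ℂ) →ₗ[ℝ] ℝ) (hf : Set.InjOn f V) :
    ∃ y x : Fin d → ℂ, 0 < f x ∧
      (P : Set (Fin d → ℂ)) = {p | ∃ k < r, p = y + (k : ℂ) • x} := by
  obtain ⟨hcard, y, x, hPyx⟩ := hP
  have hmem : ∀ k < r, y + (k : ℂ) • x ∈ P := fun k hk => by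
    rw [← Finset.mem_coe, hPyx]; exact ⟨k, hk, rfl⟩
  have hx : x ≠ 0 := by
    rintro rfl
    have : P ⊆ {y} := fun p hp => by
      rw [← Finset.mem_coe, hPyx] at hp
      obtain ⟨k, -, rfl⟩ := hp
      simp
    have := Finset.card_le_card this
    rw [Finset.card_singleton] at this
    omega
  have hfx : f x ≠ 0 := by
    intro h0
    have h1 := hf (hPV (hmem 0 (by omega))) (hPV (hmem 1 (by omega))) (by simp [h0])
    simp at h1
    exact hx h1
  rcases lt_or_gt_of_ne hfx with h | h
  · refine ⟨y + ((r - 1 : ℕ) : ℂ) • x, -x, by rw [map_neg]; linarith, ?_⟩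
    rw [hPyx]
    ext p
    constructor
    · rintro ⟨k, hk, rfl⟩
      refine ⟨r - 1 - k, by omega, ?_⟩
      rw [Nat.cast_sub (by omega : k ≤ r - 1), sub_smul, smul_neg, smul_neg]
      abel
    · rintro ⟨k, hk, rfl⟩
      refine ⟨r - 1 - k, by omega, ?_⟩
      rw [Nat.cast_sub (by omega : k ≤ r - 1), sub_smul, smul_neg]
      abel
  · exact ⟨y, x, h, hPyx⟩

/-- A real functional avoiding zero on all differences of points of `V` gives the order along lines
that `ℂ` itself lacks. -/
theorem exists_real_functional_injOn {d : ℕ} (V : Finset (Fin d → ℂ)) :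
    ∃ f : (Fin d → ℂ) →ₗ[ℝ] ℝ, Set.InjOn f V := by
  classical
  obtain ⟨f, hf⟩ := Module.exists_dual_forall_apply_ne_zero (K := ℝ)
    (fun a : V.offDiag => a.1.1 - a.1.2) (fun a => sub_ne_zero.2 (Finset.mem_offDiag.1 a.2).2.2)
  refine ⟨f, fun p hp q hq hpq => ?_⟩
  by_contra hne
  exact hf ⟨(p, q), Finset.mem_offDiag.2 ⟨hp, hq, hne⟩⟩ (by simp [hpq])

/-- At least half of the `r - 1` steps of a progression join points close in the order of their
line, and the endpoints of a step together with its index determine the progression. Hence there are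
at most twice as many progressions as close pairs. Restricting to close pairs saves a factor of
order `r` over all collinear pairs. -/
theorem numAP_le {d r : ℕ} (hr : 2 ≤ r) (V : Finset (Fin d → ℂ)) :
    numAP r V ≤ 2 * #V ^ 2 ∧
      numAP r V * (r - 1) ≤ 4 * ∑ l ∈ lineSets V with r ≤ #l, #l ^ 2 := by
  classical
  obtain ⟨f, hf⟩ := exists_real_functional_injOn V
  set N : Finset ((Fin d → ℂ) × (Fin d → ℂ)) :=
    {a ∈ V.offDiag | r ≤ #(lineThrough V a.1 a.2) ∧ f a.1 < f a.2 ∧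
      orderGap f (lineThrough V a.1 a.2) a.1 a.2 ≤ 2 * #(lineThrough V a.1 a.2) / (r - 1)} with hN
  suffices h : numAP r V ≤ 2 * #N by
    constructor
    · refine h.trans (Nat.mul_le_mul_left _ ((Finset.card_filter_le _ _).trans ?_))
      rw [Finset.offDiag_card, sq]
      exact Nat.sub_le _ _
    · have h2 := card_filter_orderGap_mul_le hf r
      rw [← hN] at h2
      calc numAP r V * (r - 1) ≤ 2 * #N * (r - 1) := Nat.mul_le_mul_right _ h
        _ = 2 * (#N * (r - 1)) := by ring
        _ ≤ 2 * (2 * ∑ l ∈ lineSets V with r ≤ #l, #l ^ 2) := Nat.mul_le_mul_left _ h2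
        _ = _ := by ring
  set 𝒜 := V.powerset.filter (fun P => IsTermAP r P) with h𝒜
  have hnum : numAP r V = #𝒜 := by
    rw [numAP, h𝒜]
  have : ∀ P : Finset (Fin d → ℂ), ∃ y x : Fin d → ℂ, P ∈ 𝒜 → 0 < f x ∧
      (P : Set (Fin d → ℂ)) = {p | ∃ k < r, p = y + (k : ℂ) • x} := by
    intro P
    by_cases hP : P ∈ 𝒜
    · rw [h𝒜, Finset.mem_filter, Finset.mem_powerset] at hP
      obtain ⟨y, x, h⟩ := hP.2.exists_increasing hr hP.1 f hf
      exact ⟨y, x, fun _ => h⟩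
    · exact ⟨0, 0, fun h => absurd h hP⟩
  choose y x hyx using this
  set a : Finset (Fin d → ℂ) → ℕ → Fin d → ℂ := fun P k => y P + (k : ℂ) • x P with ha
  have hmem : ∀ P ∈ 𝒜, ∀ k < r, a P k ∈ V := by
    intro P hP k hk
    have hPV := Finset.mem_powerset.1 (Finset.mem_filter.1 hP).1
    refine hPV ?_
    rw [← Finset.mem_coe, (hyx P hP).2]
    exact ⟨k, hk, rfl⟩
  have hfa : ∀ P k, f (a P k) = f (y P) + k * f (x P) := by
    intro P k
    have : (k : ℂ) • x P = (k : ℝ) • x P := by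
      ext i; simp
    rw [ha]
    simp only
    rw [this, map_add, map_smul, smul_eq_mul]
  have hmono : ∀ P ∈ 𝒜, StrictMono fun k => f (a P k) := by
    intro P hP i j hij
    simp only [hfa]
    have hx := (hyx P hP).1
    have : (i : ℝ) < j := by exact_mod_cast hij
    nlinarith
  have hne : ∀ P ∈ 𝒜, ∀ i j, i < j → a P i ≠ a P j := fun P hP i j hij h =>
    (hmono P hP hij).ne (congrArg f h)
  have hline : ∀ P ∈ 𝒜, ∀ k < r - 1, lineThrough V (a P k) (a P (k + 1)) =
      lineThrough V (a P 0) (a P 1) := by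
    intro P hP k hk
    have hon : ∀ j < r, a P j ∈ lineThrough V (a P 0) (a P 1) := fun j hj =>
      mem_lineThrough.2 ⟨hmem P hP j hj, j, by simp [ha]⟩
    exact lineThrough_eq (hon k (by omega)) (hon (k + 1) (by omega)) (hne P hP _ _ (by omega))
  have hsub : ∀ P ∈ 𝒜, P ⊆ lineThrough V (a P 0) (a P 1) := by
    intro P hP p hp
    rw [← Finset.mem_coe, (hyx P hP).2] at hp
    obtain ⟨k, hk, rfl⟩ := hp
    exact mem_lineThrough.2 ⟨hmem P hP k hk, k, by simp [ha]⟩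
  set good : Finset (Fin d → ℂ) → Finset ℕ := fun P =>
    {k ∈ range (r - 1) | orderGap f (lineThrough V (a P 0) (a P 1)) (a P k) (a P (k + 1)) ≤
      2 * #(lineThrough V (a P 0) (a P 1)) / (r - 1)} with hgood
  have hgoodcard : ∀ P ∈ 𝒜, r - 1 ≤ 2 * #(good P) := fun P hP =>
    le_two_mul_card_short_steps hr (fun k hk => hsub P hP (by
      rw [← Finset.mem_coe, (hyx P hP).2]; exact ⟨k, hk, rfl⟩)) (hmono P hP)
  have hinj : #(𝒜.sigma good) ≤ #(N ×ˢ range (r - 1)) := by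
    refine Finset.card_le_card_of_injOn
      (fun s => ((a s.1 s.2, a s.1 (s.2 + 1)), s.2)) ?_ ?_
    · rintro ⟨P, k⟩ hs
      rw [Finset.mem_coe, Finset.mem_sigma] at hs
      obtain ⟨hP, hk⟩ := hs
      simp only at hP hk
      rw [hgood] at hk
      obtain ⟨hk, hgap⟩ := Finset.mem_filter.1 hk
      have hk' := Finset.mem_range.1 hk
      refine Finset.mem_coe.2 (Finset.mem_product.2 ⟨Finset.mem_filter.2 ⟨?_, ?_, ?_, ?_⟩, hk⟩)
      · exact Finset.mem_offDiag.2 ⟨hmem P hP k (by omega), hmem P hP (k + 1) (by omega),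
          hne P hP _ _ (by omega)⟩
      · rw [hline P hP k hk']
        have := Finset.card_le_card (hsub P hP)
        rwa [(Finset.mem_filter.1 hP).2.1] at this
      · exact hmono P hP (Nat.lt_succ_self k)
      · rw [hline P hP k hk']
        exact hgap
    · rintro ⟨P, k⟩ hs ⟨P', k'⟩ hs' h
      rw [Finset.mem_coe, Finset.mem_sigma] at hs hs'
      simp only [Prod.mk.injEq] at h
      obtain ⟨⟨h1, h2⟩, rfl⟩ := h
      have hxx : x P = x P' := by
        have e : ∀ P, a P (k + 1) = a P k + x P := fun P => by
          simp [ha, add_smul, add_assoc]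
        rw [e, e, h1] at h2
        exact add_left_cancel h2
      have hyy : y P = y P' := by
        simp only [ha, hxx] at h1
        exact add_right_cancel h1
      have : P = P' := by
        rw [← Finset.coe_inj, (hyx P hs.1).2, (hyx P' hs'.1).2, hxx, hyy]
      subst this
      rfl
  rw [Finset.card_sigma, Finset.card_product, Finset.card_range] at hinj
  have h1 : #𝒜 * (r - 1) ≤ 2 * #N * (r - 1) := by
    calc #𝒜 * (r - 1) = ∑ P ∈ 𝒜, (r - 1) := by rw [Finset.sum_const, smul_eq_mul]
      _ ≤ ∑ P ∈ 𝒜, 2 * #(good P) := Finset.sum_le_sum hgoodcard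
      _ = 2 * ∑ P ∈ 𝒜, #(good P) := by rw [Finset.mul_sum]
      _ ≤ 2 * (#N * (r - 1)) := Nat.mul_le_mul_left _ hinj
      _ = _ := by ring
  rw [hnum]
  exact Nat.le_of_mul_le_mul_right h1 (by omega)

/-- Pruning: a set family that is heavy on `V` has a nonempty subset on which every point lies in
many sets with more than `m` points. -/
theorem exists_pruned_subset {β : Type*} [DecidableEq β] (𝓛 : Finset (Finset β)) (V : Finset β)
    (m : ℕ) (hpos : 0 < ∑ l ∈ 𝓛, (#(l ∩ V) - m) ^ 2) :
    ∃ S ⊆ V, S.Nonempty ∧ ∀ p ∈ S, ∑ l ∈ 𝓛, (#(l ∩ V) - m) ^ 2 ≤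
      4 * #V * ∑ l ∈ 𝓛 with m < #(l ∩ S) ∧ p ∈ l, #(l ∩ S) := by
  set Φ : Finset β → ℕ := fun S => ∑ l ∈ 𝓛, (#(l ∩ S) - m) ^ 2 with hΦ
  -- At a maximizer, deleting any point must lower `Φ` by at least `Φ V / (2 * #V)`, and only sets
  -- through that point with more than `m` points of `S` contribute, by truncated subtraction. The
  -- value at `V` is positive, which rules out the empty set.
  obtain ⟨S, hS, hmax⟩ := Finset.exists_max_image V.powerset
    (fun S => (2 * #V * Φ S : ℤ) - Φ V * #S) ⟨V, Finset.mem_powerset_self V⟩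
  rw [Finset.mem_powerset] at hS
  have hV : 0 < #V := by
    rcases Finset.eq_empty_or_nonempty V with rfl | h
    · simp at hpos
    · exact Finset.card_pos.2 h
  refine ⟨S, hS, ?_, fun p hp => ?_⟩
  · rw [Finset.nonempty_iff_ne_empty]
    rintro rfl
    have h1 := hmax V (Finset.mem_powerset_self V)
    have h2 : Φ ∅ = 0 := by simp [hΦ]
    simp only [h2, Finset.card_empty] at h1
    have h3 : 0 < (Φ V : ℤ) * #V := by exact_mod_cast Nat.mul_pos hpos hV
    push_cast at h1
    linarith
  · have h1 := hmax (S.erase p) (Finset.mem_powerset.2 ((Finset.erase_subset _ _).trans hS))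
    have hdiff : Φ S ≤ Φ (S.erase p) + 2 * ∑ l ∈ 𝓛 with m < #(l ∩ S) ∧ p ∈ l, #(l ∩ S) := by
      rw [hΦ, Finset.sum_filter, Finset.mul_sum]
      simp only
      rw [← Finset.sum_add_distrib]
      refine Finset.sum_le_sum fun l _ => ?_
      rw [Finset.inter_erase]
      split_ifs with h
      · rw [Finset.card_erase_of_mem (Finset.mem_inter.2 ⟨h.2, hp⟩)]
        obtain ⟨t, ht⟩ := Nat.exists_eq_add_of_lt h.1
        rw [ht, show m + t + 1 - m = t + 1 by omega, show m + t + 1 - 1 - m = t by omega]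
        nlinarith
      · by_cases hpl : p ∈ l
        · have : #(l ∩ S) - m = 0 := by
            have : ¬ m < #(l ∩ S) := fun hm => h ⟨hm, hpl⟩
            omega
          rw [this]; simp
        · rw [Finset.erase_eq_of_notMem (fun hm => hpl (Finset.mem_inter.1 hm).1)]
          simp
    rw [Finset.card_erase_of_mem hp, Nat.cast_sub (Finset.card_pos.2 ⟨p, hp⟩)] at h1
    set T := ∑ l ∈ 𝓛 with m < #(l ∩ S) ∧ p ∈ l, #(l ∩ S)
    change Φ V ≤ _
    have hdiff' : (Φ S : ℤ) ≤ Φ (S.erase p) + 2 * T := by exact_mod_cast hdiff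
    have hVz : (0 : ℤ) < #V := by exact_mod_cast hV
    have : (Φ V : ℤ) ≤ 4 * #V * T := by
      push_cast at h1
      nlinarith
    exact_mod_cast this

end

/-! ### The polynomial method: vanishing polynomials and tangent hyperplanes. -/

section

open Finset

theorem MvPolynomial.totalDegree_pderiv_lt {σ : Type*} {f : MvPolynomial σ ℂ} {i : σ}
    (h : pderiv i f ≠ 0) : (pderiv i f).totalDegree < f.totalDegree := by
  classical
  have key : ∀ m ∈ (pderiv i f).support, m.degree + 1 ≤ f.totalDegree := by
    intro m hm
    rw [mem_support_iff, coeff_pderiv] at hm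
    have : m + Finsupp.single i 1 ∈ f.support := mem_support_iff.2 (left_ne_zero_of_mul hm)
    have := le_totalDegree this
    change (m + Finsupp.single i 1).degree ≤ _ at this
    rwa [map_add, Finsupp.degree_single] at this
  obtain ⟨m, hm⟩ := support_nonempty.2 h
  have hpos : 0 < f.totalDegree := by have := key m hm; omega
  refine (Finset.sup_lt_iff hpos).2 fun m hm => ?_
  exact key m hm

/-- In characteristic zero a nonconstant coefficient is recovered from a partial derivative by
dividing by a nonzero exponent. -/
theorem MvPolynomial.eq_C_of_pderiv_eq_zero {σ : Type*} {f : MvPolynomial σ ℂ}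
    (h : ∀ i, pderiv i f = 0) : f = C (coeff 0 f) := by
  classical
  ext m
  rw [coeff_C]
  split_ifs with h0
  · rw [h0]
  · obtain ⟨i, hi⟩ : ∃ i, m i ≠ 0 := by
      by_contra hcon
      push Not at hcon
      exact h0 (Finsupp.ext fun i => (hcon i).symm)
    have hm : m - Finsupp.single i 1 + Finsupp.single i 1 = m :=
      tsub_add_cancel_of_le (Finsupp.single_le_iff.2 (Nat.one_le_iff_ne_zero.2 hi))
    have h1 := coeff_pderiv (i := i) f (m - Finsupp.single i 1)
    rw [h i, coeff_zero, hm] at h1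
    rcases mul_eq_zero.1 h1.symm with h2 | h2
    · exact h2
    · exact absurd h2 (Nat.cast_add_one_ne_zero _)

/-- A polynomial vanishing on a set can be replaced by one, of no larger degree, with a nonzero
gradient at some point of the set. -/
theorem exists_vanishing_pderiv_ne_zero {d : ℕ} {S : Finset (Fin d → ℂ)} (hS : S.Nonempty) :
    ∀ (D : ℕ) (f : MvPolynomial (Fin d) ℂ), f ≠ 0 → f.totalDegree ≤ D →
      (∀ p ∈ S, MvPolynomial.eval p f = 0) →
      ∃ f' : MvPolynomial (Fin d) ℂ, f'.totalDegree ≤ D ∧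
        (∀ p ∈ S, MvPolynomial.eval p f' = 0) ∧
        ∃ p ∈ S, ∃ i, MvPolynomial.eval p (MvPolynomial.pderiv i f') ≠ 0 := by
  intro D
  induction D with
  | zero =>
    intro f hf hdeg hvan
    obtain ⟨p, hp⟩ := hS
    have hC := MvPolynomial.totalDegree_eq_zero_iff_eq_C.1 (Nat.le_zero.1 hdeg)
    have := hvan p hp
    rw [hC, MvPolynomial.eval_C] at this
    rw [this, map_zero] at hC
    exact absurd hC hf
  | succ D ih =>
    intro f hf hdeg hvan
    by_cases hgood : ∃ p ∈ S, ∃ i, MvPolynomial.eval p (MvPolynomial.pderiv i f) ≠ 0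
    · exact ⟨f, hdeg, hvan, hgood⟩
    push Not at hgood
    by_cases hz : ∀ i, MvPolynomial.pderiv i f = 0
    · have hC := MvPolynomial.eq_C_of_pderiv_eq_zero hz
      obtain ⟨p, hp⟩ := hS
      have := hvan p hp
      rw [hC, MvPolynomial.eval_C] at this
      rw [this, map_zero] at hC
      exact absurd hC hf
    · push Not at hz
      obtain ⟨i, hi⟩ := hz
      have hlt := MvPolynomial.totalDegree_pderiv_lt hi
      -- All first derivatives vanish on `S` here, so a nonzero one is a vanishing polynomial of
      -- smaller degree.
      obtain ⟨f', h1, h2⟩ := ih _ hi (by omega) fun p hp => hgood p hp i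
      exact ⟨f', by omega, h2⟩

/-- The restriction of a polynomial to the parametrized line `w ↦ y + w • x`. -/
noncomputable def lineRestrict {d : ℕ} (y x : Fin d → ℂ) :
    MvPolynomial (Fin d) ℂ →ₐ[ℂ] Polynomial ℂ :=
  MvPolynomial.aeval fun i => Polynomial.C (y i) + Polynomial.C (x i) * Polynomial.X

theorem natDegree_lineRestrict_le {d : ℕ} (y x : Fin d → ℂ) (f : MvPolynomial (Fin d) ℂ) :
    (lineRestrict y x f).natDegree ≤ f.totalDegree := by
  refine (MvPolynomial.aeval_natDegree_le f le_rfl _ (n := 1) fun i => ?_).trans_eq (mul_one _)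
  refine (Polynomial.natDegree_add_le _ _).trans (max_le (by simp) ?_)
  exact (Polynomial.natDegree_C_mul_le _ _).trans Polynomial.natDegree_X_le

theorem eval_lineRestrict {d : ℕ} (y x : Fin d → ℂ) (f : MvPolynomial (Fin d) ℂ) (w : ℂ) :
    (lineRestrict y x f).eval w = MvPolynomial.eval (y + w • x) f := by
  induction f using MvPolynomial.induction_on with
  | C a => simp [lineRestrict]
  | add f g hf hg => rw [map_add, Polynomial.eval_add, hf, hg, map_add]
  | mul_X f i hf =>
    rw [map_mul, Polynomial.eval_mul, hf, map_mul]
    congr 1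
    simp only [lineRestrict, MvPolynomial.aeval_X, MvPolynomial.eval_X, Polynomial.eval_add,
      Polynomial.eval_C_mul, Polynomial.eval_C, Polynomial.eval_X, Pi.add_apply, Pi.smul_apply,
      smul_eq_mul]
    ring

/-- The chain rule along a line, by induction on the polynomial. -/
theorem eval_derivative_lineRestrict {d : ℕ} (y x : Fin d → ℂ) (f : MvPolynomial (Fin d) ℂ)
    (w : ℂ) : (Polynomial.derivative (lineRestrict y x f)).eval w =
      ∑ i, MvPolynomial.eval (y + w • x) (MvPolynomial.pderiv i f) * x i := by
  induction f using MvPolynomial.induction_on with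
  | C a => simp [lineRestrict]
  | add f g hf hg =>
    rw [map_add, Polynomial.derivative_add, Polynomial.eval_add, hf, hg, ← Finset.sum_add_distrib]
    refine Finset.sum_congr rfl fun i _ => ?_
    rw [map_add, map_add, add_mul]
  | mul_X f j hf =>
    rw [map_mul, Polynomial.derivative_mul, Polynomial.eval_add, Polynomial.eval_mul,
      Polynomial.eval_mul, hf, eval_lineRestrict, eval_lineRestrict]
    have h1 : (Polynomial.derivative (lineRestrict y x (MvPolynomial.X j))).eval w = x j := by
      simp [lineRestrict]
    rw [h1]
    have h2 : ∀ i, MvPolynomial.eval (y + w • x) (MvPolynomial.pderiv i (f * MvPolynomial.X j)) *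
        x i = MvPolynomial.eval (y + w • x) (MvPolynomial.pderiv i f) * x i *
          MvPolynomial.eval (y + w • x) (MvPolynomial.X j) +
        if i = j then MvPolynomial.eval (y + w • x) f * x j else 0 := by
      intro i
      rw [MvPolynomial.pderiv_mul, map_add, map_mul, map_mul]
      split_ifs with hij
      · subst hij
        rw [MvPolynomial.pderiv_X_self, map_one]
        ring
      · rw [MvPolynomial.pderiv_X_of_ne (Ne.symm hij), map_zero]
        ring
    simp_rw [h2]
    rw [Finset.sum_add_distrib, ← Finset.sum_mul, Finset.sum_ite_eq' Finset.univ j]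
    simp

/-- The polynomial with given coefficients, of degree at most `g` in each variable. -/
noncomputable def boxPolynomial (d g : ℕ) :
    ((Fin d → Fin (g + 1)) → ℂ) →ₗ[ℂ] MvPolynomial (Fin d) ℂ :=
  ∑ e : Fin d → Fin (g + 1),
    (MvPolynomial.monomial (Finsupp.equivFunOnFinite.symm fun i => (e i : ℕ))).comp
      (LinearMap.proj e)

theorem boxPolynomial_apply {d g : ℕ} (c : (Fin d → Fin (g + 1)) → ℂ) :
    boxPolynomial d g c = ∑ e : Fin d → Fin (g + 1),
      MvPolynomial.monomial (Finsupp.equivFunOnFinite.symm fun i => (e i : ℕ)) (c e) := by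
  simp [boxPolynomial]

theorem totalDegree_boxPolynomial_le {d g : ℕ} (c : (Fin d → Fin (g + 1)) → ℂ) :
    (boxPolynomial d g c).totalDegree ≤ d * g := by
  rw [boxPolynomial_apply]
  refine MvPolynomial.totalDegree_finsetSum_le fun e _ => ?_
  refine (MvPolynomial.totalDegree_monomial_le _ _).trans ?_
  rw [Finsupp.sum_fintype _ _ (fun _ => rfl)]
  refine (Finset.sum_le_card_nsmul _ _ g fun i _ => ?_).trans_eq (by simp)
  exact Nat.lt_succ_iff.1 (e i).2

theorem boxPolynomial_injective (d g : ℕ) : Function.Injective (boxPolynomial d g) := by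
  classical
  refine (injective_iff_map_eq_zero _).2 fun c hc => funext fun e => ?_
  have h := congrArg
    (MvPolynomial.coeff (Finsupp.equivFunOnFinite.symm fun i => (e i : ℕ))) hc
  rw [boxPolynomial_apply, MvPolynomial.coeff_sum, MvPolynomial.coeff_zero,
    Finset.sum_eq_single e] at h
  · simpa [MvPolynomial.coeff_monomial] using h
  · intro e' _ hne
    rw [MvPolynomial.coeff_monomial, if_neg]
    intro heq
    refine hne (funext fun i => Fin.ext ?_)
    exact DFunLike.congr_fun heq i
  · simp

/-- If the lines with more than `m` points of `S` are sufficiently heavy at every point of `S`,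
then a nonzero polynomial of low degree vanishes on `S`. -/
theorem exists_vanishing_of_heavy_lines {d g m : ℕ} {V S : Finset (Fin d → ℂ)}
    (hm : 4 * (d * g + 1) ≤ m + 1) {κ : ℝ} [DecidableEq (Fin d → ℂ)]
    (hκ : ∀ p ∈ S, κ ≤ ((∑ l ∈ lineSets V with m < #(l ∩ S) ∧ p ∈ l, #(l ∩ S) : ℕ) : ℝ))
    (hlarge : 4 * ((d * g + 1 : ℕ) : ℝ) * #S < (g + 1 : ℝ) ^ d * κ) :
    ∃ f : MvPolynomial (Fin d) ℂ, f ≠ 0 ∧ f.totalDegree ≤ d * g ∧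
      ∀ p ∈ S, MvPolynomial.eval p f = 0 := by
  classical
  let ev : MvPolynomial (Fin d) ℂ →ₗ[ℂ] (S → ℂ) :=
    LinearMap.pi fun p => (MvPolynomial.aeval (p : Fin d → ℂ)).toLinearMap
  have hev : ∀ f p, ev f p = MvPolynomial.eval (p : Fin d → ℂ) f := fun f p => by
    simp [ev, MvPolynomial.aeval_eq_eval]
  let T := ev.comp (boxPolynomial d g)
  -- Injectivity would give a space of dimension `(g + 1) ^ d` on `S`, contradicting the rank bound
  -- with `h = d * g + 1`; a kernel element is the wanted polynomial.
  by_cases hT : Function.Injective T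
  · exfalso
    set L : Finset (Fin d → ℂ) → Finset S := fun l => univ.filter fun p => (p : Fin d → ℂ) ∈ l
      with hL
    have hLcard : ∀ l, #(L l) = #(l ∩ S) := by
      intro l
      rw [hL, ← Finset.card_map (Function.Embedding.subtype _)]
      congr 1
      ext p
      simp [and_comm]
    set I := (lineSets V).filter fun l => m < #(l ∩ S) with hI
    have hIl : ∀ l ∈ I, l ∈ lineSets V := fun l hl => (Finset.mem_filter.1 hl).1
    have : ∀ l, ∃ (y x : Fin d → ℂ) (z : (Fin d → ℂ) → ℂ), l ∈ I →
        ∀ v ∈ l, v = y + z v • x := by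
      intro l
      by_cases hl : l ∈ I
      · obtain ⟨y, x, z, h⟩ := exists_param_of_mem_lineSets (hIl l hl)
        exact ⟨y, x, z, fun _ => h⟩
      · exact ⟨0, 0, 0, fun h => absurd h hl⟩
    choose y x z hz using this
    have hmemL : ∀ {l} {p : S}, p ∈ L l ↔ (p : Fin d → ℂ) ∈ l := by simp [hL]
    have hrank := finrank_mul_le_of_blocks (Nat.le_add_left 1 (d * g)) I L
      (fun l p => z l p) ?_ ?_ ?_ (κ := κ) ?_ (LinearMap.range T) ?_
    · rw [LinearMap.finrank_range_of_inj hT, Module.finrank_fintype_fun_eq_card,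
        Fintype.card_fun, Fintype.card_fin, Fintype.card_fin, Fintype.card_coe] at hrank
      push_cast at hrank hlarge
      linarith
    · intro l hl p hp q hq hpq
      refine Subtype.ext ?_
      rw [hz l hl p (hmemL.1 hp), hz l hl q (hmemL.1 hq)]
      simp only at hpq
      rw [hpq]
    · intro l hl
      rw [hLcard]
      have := (Finset.mem_filter.1 hl).2
      omega
    · intro l hl l' hl' hne p q hp hp' hq hq'
      exact Subtype.ext (eq_of_mem_lineSets (hIl l hl) (hIl l' hl') hne (hmemL.1 hp)
        (hmemL.1 hp') (hmemL.1 hq) (hmemL.1 hq'))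
    · intro p
      refine (hκ p p.2).trans_eq ?_
      rw [hI, Finset.filter_filter]
      push_cast
      refine Finset.sum_congr (Finset.filter_congr fun l _ => ?_) fun l _ => by rw [hLcard]
      rw [hmemL]
    · rintro _ ⟨c, rfl⟩ l hl
      refine ⟨lineRestrict (y l) (x l) (boxPolynomial d g c), ?_, fun p hp => ?_⟩
      · refine Polynomial.degree_le_natDegree.trans_lt ?_
        have := (natDegree_lineRestrict_le (y l) (x l) (boxPolynomial d g c)).trans
          (totalDegree_boxPolynomial_le c)
        exact_mod_cast Nat.lt_succ_of_le this
      · rw [eval_lineRestrict, ← hz l hl p (hmemL.1 hp)]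
        exact hev _ _
  · rw [injective_iff_map_eq_zero] at hT
    push Not at hT
    obtain ⟨c, hc, hc0⟩ := hT
    refine ⟨boxPolynomial d g c, fun h => hc0 (boxPolynomial_injective d g (by rw [h, map_zero])),
      totalDegree_boxPolynomial_le c, fun p hp => ?_⟩
    have := congrFun hc ⟨p, hp⟩
    rw [← hev _ ⟨p, hp⟩]
    exact this

/-- A line containing more zeros than the degree is tangent to the zero set at each of its
points. -/
theorem sum_pderiv_mul_eq_of_many_zeros {d m : ℕ} {V S : Finset (Fin d → ℂ)}
    [DecidableEq (Fin d → ℂ)] {l : Finset (Fin d → ℂ)} (hl : l ∈ lineSets V)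
    (hm : m < #(l ∩ S)) {f : MvPolynomial (Fin d) ℂ} (hf : f.totalDegree ≤ m)
    (hvan : ∀ p ∈ S, MvPolynomial.eval p f = 0) {p q : Fin d → ℂ} (hp : p ∈ l) (hq : q ∈ l) :
    ∑ i, MvPolynomial.eval p (MvPolynomial.pderiv i f) * q i =
      ∑ i, MvPolynomial.eval p (MvPolynomial.pderiv i f) * p i := by
  classical
  obtain ⟨y, x, z, hz⟩ := exists_param_of_mem_lineSets hl
  have hinj : Set.InjOn z (l ∩ S : Finset (Fin d → ℂ)) := by
    intro u hu v hv huv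
    rw [hz u (Finset.mem_inter.1 hu).1, hz v (Finset.mem_inter.1 hv).1, huv]
  have h0 : lineRestrict y x f = 0 := by
    refine Polynomial.eq_zero_of_natDegree_lt_card_of_eval_eq_zero' _ ((l ∩ S).image z) ?_ ?_
    · intro w hw
      obtain ⟨v, hv, rfl⟩ := Finset.mem_image.1 hw
      rw [eval_lineRestrict, ← hz v (Finset.mem_inter.1 hv).1]
      exact hvan v (Finset.mem_inter.1 hv).2
    · rw [Finset.card_image_of_injOn hinj]
      exact ((natDegree_lineRestrict_le y x f).trans hf).trans_lt hm
  have h1 := eval_derivative_lineRestrict y x f (z p)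
  rw [h0, Polynomial.derivative_zero, Polynomial.eval_zero, ← hz p hp] at h1
  have hqp : ∀ i, q i = p i + (z q - z p) * x i := by
    intro i
    have e1 := congrFun (hz q hq) i
    have e2 := congrFun (hz p hp) i
    simp only [Pi.add_apply, Pi.smul_apply, smul_eq_mul] at e1 e2
    linear_combination e1 - e2
  calc ∑ i, MvPolynomial.eval p (MvPolynomial.pderiv i f) * q i
      = ∑ i, MvPolynomial.eval p (MvPolynomial.pderiv i f) * p i + (z q - z p) *
        ∑ i, MvPolynomial.eval p (MvPolynomial.pderiv i f) * x i := by
        rw [Finset.mul_sum, ← Finset.sum_add_distrib]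
        exact Finset.sum_congr rfl fun i _ => by rw [hqp]; ring
    _ = _ := by rw [← h1, mul_zero, add_zero]

/-- Every heavy line through a point `p` of nonzero gradient lies in the tangent hyperplane at `p`.
These lines share only `p`, and dropping `p` from each loses at most half of its points. -/
theorem exists_hyperplane_of_heavy_lines {d g m : ℕ} {V S : Finset (Fin d → ℂ)} (hSV : S ⊆ V)
    (hS : S.Nonempty) (hm : 4 * (d * g + 1) ≤ m + 1) {κ : ℝ} [DecidableEq (Fin d → ℂ)]
    (hκ : ∀ p ∈ S, κ ≤ ((∑ l ∈ lineSets V with m < #(l ∩ S) ∧ p ∈ l, #(l ∩ S) : ℕ) : ℝ))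
    (hlarge : 4 * ((d * g + 1 : ℕ) : ℝ) * #S < (g + 1 : ℝ) ^ d * κ) :
    ∃ W ⊆ V, (∃ H : Set (Fin d → ℂ), IsAffineHyperplane H ∧ (W : Set (Fin d → ℂ)) ⊆ H) ∧
      κ ≤ 2 * #W := by
  classical
  obtain ⟨f₀, hf₀, hdeg₀, hvan₀⟩ := exists_vanishing_of_heavy_lines hm hκ hlarge
  obtain ⟨f, hdeg, hvan, p, hp, i, hi⟩ :=
    exists_vanishing_pderiv_ne_zero hS _ f₀ hf₀ hdeg₀ hvan₀
  set a : Fin d → ℂ := fun i => MvPolynomial.eval p (MvPolynomial.pderiv i f) with ha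
  refine ⟨V.filter fun v => ∑ i, a i * v i = ∑ i, a i * p i, Finset.filter_subset _ _,
    ⟨{v | ∑ i, a i * v i = ∑ i, a i * p i}, ⟨a, _, fun h => hi (congrFun h i), rfl⟩,
      fun v hv => (Finset.mem_filter.1 hv).2⟩, (hκ p hp).trans ?_⟩
  norm_cast
  set I := (lineSets V).filter fun l => m < #(l ∩ S) ∧ p ∈ l with hI
  have hsub : I.biUnion (fun l => (l ∩ S).erase p) ⊆
      V.filter fun v => ∑ i, a i * v i = ∑ i, a i * p i := by
    intro v hv
    obtain ⟨l, hl, hv⟩ := Finset.mem_biUnion.1 hv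
    have hv := Finset.mem_inter.1 (Finset.mem_of_mem_erase hv)
    obtain ⟨hlV, hlm, hpl⟩ := Finset.mem_filter.1 hl
    refine Finset.mem_filter.2 ⟨hSV hv.2, ?_⟩
    exact sum_pderiv_mul_eq_of_many_zeros hlV hlm (by omega) hvan hpl hv.1
  refine le_trans ?_ (Nat.mul_le_mul_left 2 (Finset.card_le_card hsub))
  rw [Finset.card_biUnion, Finset.mul_sum]
  · refine Finset.sum_le_sum fun l hl => ?_
    obtain ⟨hlV, hlm, hpl⟩ := Finset.mem_filter.1 hl
    rw [Finset.card_erase_of_mem (Finset.mem_inter.2 ⟨hpl, hp⟩)]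
    omega
  · intro l hl l' hl' hne
    obtain ⟨hlV, -, hpl⟩ := Finset.mem_filter.1 hl
    obtain ⟨hlV', -, hpl'⟩ := Finset.mem_filter.1 hl'
    refine Finset.disjoint_left.2 fun v hv hv' => ?_
    exact Finset.ne_of_mem_erase hv (eq_of_mem_lineSets hlV hlV' hne hpl hpl'
      (Finset.mem_inter.1 (Finset.mem_of_mem_erase hv)).1
      (Finset.mem_inter.1 (Finset.mem_of_mem_erase hv')).1)

/-- A set with many `r`-term progressions has many points on a hyperplane. -/
theorem exists_hyperplane_of_numAP {d r : ℕ} (hd : 1 ≤ d) (hr : 16 * d ≤ r)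
    {V : Finset (Fin d → ℂ)} (hV : V.Nonempty)
    (hAP : 65 * (16 * d : ℝ) ^ d * (#V : ℝ) ^ 2 ≤ (r : ℝ) ^ d * numAP r V) :
    ∃ W ⊆ V, (∃ H : Set (Fin d → ℂ), IsAffineHyperplane H ∧ (W : Set (Fin d → ℂ)) ⊆ H) ∧
      (r : ℝ) * numAP r V ≤ 256 * #V * #W := by
  classical
  have hr16 : 16 ≤ r := by omega
  have hVpos : (0 : ℝ) < #V := by exact_mod_cast Finset.card_pos.2 hV
  have hrpos : (0 : ℝ) < r := by positivity
  have hdpos : (0 : ℝ) < d := by exact_mod_cast hd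
  -- A line with `#l ≥ r` keeps `#l - m ≥ #l / 2`, so `Φ` retains a quarter of its square.
  set m := r / 2 with hmdef
  set Φ := ∑ l ∈ lineSets V, (#(l ∩ V) - m) ^ 2 with hΦ
  have hΦlow : r * numAP r V ≤ 32 * Φ := by
    have h1 := (numAP_le (by omega : 2 ≤ r) V).2
    have h2 : ∑ l ∈ lineSets V with r ≤ #l, #l ^ 2 ≤ 4 * Φ := by
      rw [hΦ, Finset.mul_sum]
      refine (Finset.sum_le_sum fun l hl => ?_).trans
        (Finset.sum_le_sum_of_subset (Finset.filter_subset (fun l => r ≤ #l) _))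
      obtain ⟨hl, hlr⟩ := Finset.mem_filter.1 hl
      rw [Finset.inter_eq_left.2 (subset_of_mem_lineSets hl)]
      have : #l ≤ 2 * (#l - m) := by omega
      calc #l ^ 2 ≤ (2 * (#l - m)) ^ 2 := Nat.pow_le_pow_left this 2
        _ = 4 * (#l - m) ^ 2 := by ring
    have h3 : r ≤ 2 * (r - 1) := by omega
    calc r * numAP r V ≤ 2 * (r - 1) * numAP r V := Nat.mul_le_mul_right _ h3
      _ = 2 * (numAP r V * (r - 1)) := by ring
      _ ≤ 2 * (4 * (4 * Φ)) := by omega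
      _ = 32 * Φ := by ring
  have hΦlow' : (r : ℝ) * numAP r V ≤ 32 * Φ := by exact_mod_cast hΦlow
  have hAPpos : (0 : ℝ) < numAP r V := by
    by_contra hcon
    have h0 : (r : ℝ) ^ d * numAP r V ≤ 0 :=
      mul_nonpos_of_nonneg_of_nonpos (by positivity) (not_lt.1 hcon)
    have : 0 < 65 * (16 * d : ℝ) ^ d * (#V : ℝ) ^ 2 := by positivity
    linarith
  have hΦpos : 0 < Φ := by
    have : (0 : ℝ) < Φ := by nlinarith [mul_pos hrpos hAPpos]
    exact_mod_cast this
  obtain ⟨S, hSV, hS, hdeg⟩ := exists_pruned_subset (lineSets V) V m hΦpos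
  -- Large enough that `16 * d * (g + 1)` exceeds `r`, small enough that `4 * (d * g + 1) ≤ m + 1`
  -- when `r ≥ 16`.
  set g := r / (16 * d) with hg
  have hg16 : 16 * (d * g) ≤ r := by
    have := Nat.mul_div_le r (16 * d)
    rw [← hg] at this
    linarith
  have hgr : (r : ℝ) < 16 * d * (g + 1) := by
    have : r < 16 * d * (g + 1) := Nat.lt_mul_div_succ r (by omega)
    exact_mod_cast this
  set κ : ℝ := Φ / (4 * #V) with hκ
  have hκ' : ∀ p ∈ S,
      κ ≤ ((∑ l ∈ lineSets V with m < #(l ∩ S) ∧ p ∈ l, #(l ∩ S) : ℕ) : ℝ) := by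
    intro p hp
    rw [hκ, div_le_iff₀ (by positivity)]
    have := hdeg p hp
    rw [← hΦ] at this
    have : (Φ : ℝ) ≤ 4 * #V *
        ((∑ l ∈ lineSets V with m < #(l ∩ S) ∧ p ∈ l, #(l ∩ S) : ℕ) : ℝ) := by
      exact_mod_cast this
    linarith
  have hκlow : (r : ℝ) * numAP r V ≤ 128 * #V * κ := by
    have : 128 * (#V : ℝ) * κ = 32 * Φ := by rw [hκ]; field_simp; norm_num
    rw [this]
    exact hΦlow'
  have hκpos : 0 < κ := by rw [hκ]; positivity
  have hlarge : 4 * ((d * g + 1 : ℕ) : ℝ) * #S < (g + 1 : ℝ) ^ d * κ := by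
    have h1 : (#S : ℝ) ≤ #V := by exact_mod_cast Finset.card_le_card hSV
    have h2 : 4 * ((d * g + 1 : ℕ) : ℝ) ≤ r / 2 := by
      have : 8 * (d * g + 1) ≤ r := by omega
      have : (8 : ℝ) * ((d * g + 1 : ℕ) : ℝ) ≤ r := by exact_mod_cast this
      linarith
    have h3 : 4 * ((d * g + 1 : ℕ) : ℝ) * #S ≤ r / 2 * #V :=
      mul_le_mul h2 h1 (by positivity) (by positivity)
    refine h3.trans_lt ?_
    have h4 : (r : ℝ) ^ d ≤ (16 * d : ℝ) ^ d * (g + 1 : ℝ) ^ d := by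
      rw [← mul_pow]
      exact pow_le_pow_left₀ hrpos.le hgr.le d
    have hA : (0 : ℝ) < (16 * d : ℝ) ^ d := by positivity
    set A : ℝ := (16 * d : ℝ) ^ d
    have h5 : (r : ℝ) * (65 * A * (#V : ℝ) ^ 2) ≤ A * (g + 1 : ℝ) ^ d * (128 * #V * κ) := by
      calc (r : ℝ) * (65 * A * (#V : ℝ) ^ 2) ≤ r * ((r : ℝ) ^ d * numAP r V) :=
            mul_le_mul_of_nonneg_left hAP hrpos.le
        _ = (r : ℝ) ^ d * (r * numAP r V) := by ring
        _ ≤ A * (g + 1 : ℝ) ^ d * (128 * #V * κ) :=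
            mul_le_mul h4 hκlow (by positivity) (by positivity)
    -- The goal needs `64 * r * #V < 128 * (g + 1) ^ d * κ`; the constant `65` supplies the
    -- strictness.
    have h6 : (A * #V) * (65 * r * #V) ≤ (A * #V) * (128 * ((g + 1 : ℝ) ^ d * κ)) := by
      linarith
    have h7 := le_of_mul_le_mul_left h6 (by positivity)
    have h8 : 0 < (r : ℝ) * #V := by positivity
    linarith
  obtain ⟨W, hWV, hWH, hW⟩ := exists_hyperplane_of_heavy_lines hSV hS (by omega) hκ' hlarge
  refine ⟨W, hWV, hWH, hκlow.trans ?_⟩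
  have := mul_le_mul_of_nonneg_left hW hVpos.le
  linarith

end

/-! ### The theorem: choice of constants and exponents. -/

theorem theorem2 (d : ℕ) (hd : 1 ≤ d) (ε : ℝ) (hε0 : 0 < ε) (hε1 : ε < 1) :
    ∃ C c : ℝ, 0 < C ∧ 0 < c ∧
      ∀ (V : Finset (Fin d → ℂ)) (r : ℕ), 4 ≤ r →
        C * ((V.card : ℝ) ^ 2 / (r : ℝ) ^ ((d : ℝ) - ε)) ≤ (numAP r V : ℝ) →
        ∃ W : Finset (Fin d → ℂ), W ⊆ V ∧
          (∃ H : Set (Fin d → ℂ), IsAffineHyperplane H ∧ (W : Set (Fin d → ℂ)) ⊆ H) ∧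
          c * ((V.card : ℝ) / (r : ℝ) ^ (2 * (d : ℝ) / ε - 1)) ≤ (W.card : ℝ) := by
  have hdpos : (1 : ℝ) ≤ d := by exact_mod_cast hd
  have hA : (1 : ℝ) ≤ (16 * d : ℝ) ^ d := one_le_pow₀ (by linarith)
  set A : ℝ := (16 * d : ℝ) ^ d with hAdef
  -- The constants do not depend on `ε`: the argument only needs the weaker lower bound with `r ^ d`
  -- in place of `r ^ (d - ε)`.
  refine ⟨65 * A, 1 / 256, by positivity, by norm_num, fun V r hr hAP => ?_⟩
  have hr1 : (1 : ℝ) ≤ r := by exact_mod_cast (by omega : 1 ≤ r)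
  have hrpos : (0 : ℝ) < r := by linarith
  rcases V.eq_empty_or_nonempty with rfl | hV
  · refine ⟨∅, subset_rfl, ⟨{x | ∑ i, (1 : Fin d → ℂ) i * x i = 0}, ⟨1, 0, ?_, rfl⟩, by simp⟩,
      by simp⟩
    exact fun h => one_ne_zero (congrFun h ⟨0, hd⟩)
  have hVpos : (0 : ℝ) < V.card := by exact_mod_cast Finset.card_pos.2 hV
  have hAP' : 65 * A * (V.card : ℝ) ^ 2 ≤ (r : ℝ) ^ d * numAP r V := by
    have h1 : (r : ℝ) ^ ((d : ℝ) - ε) ≤ (r : ℝ) ^ d := by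
      rw [← Real.rpow_natCast]
      exact Real.rpow_le_rpow_of_exponent_le hr1 (by linarith)
    rw [← mul_div_assoc, div_le_iff₀ (Real.rpow_pos_of_pos hrpos _)] at hAP
    calc 65 * A * (V.card : ℝ) ^ 2 ≤ numAP r V * (r : ℝ) ^ ((d : ℝ) - ε) := hAP
      _ ≤ numAP r V * (r : ℝ) ^ d := mul_le_mul_of_nonneg_left h1 (Nat.cast_nonneg _)
      _ = _ := mul_comm _ _
  -- For smaller `r` the trivial bound `2 * n²` on the number of progressions contradicts `hAP'`,
  -- since `r ^ d ≤ A` and `2 < 65`.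
  have hbig : 16 * d ≤ r := by
    by_contra hcon
    have h1 : (r : ℝ) ^ d ≤ A :=
      pow_le_pow_left₀ hrpos.le (by exact_mod_cast (not_le.1 hcon).le) d
    have h2 : (numAP r V : ℝ) ≤ 2 * (V.card : ℝ) ^ 2 := by
      exact_mod_cast (numAP_le (by omega : 2 ≤ r) V).1
    have h3 : (r : ℝ) ^ d * numAP r V ≤ A * (2 * (V.card : ℝ) ^ 2) :=
      mul_le_mul h1 h2 (Nat.cast_nonneg _) (by linarith)
    have h4 : 0 < A * (V.card : ℝ) ^ 2 := by positivity
    linarith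
  obtain ⟨W, hWV, hWH, hW⟩ := exists_hyperplane_of_numAP hd hbig hV hAP'
  refine ⟨W, hWV, hWH, ?_⟩
  -- The argument gives `#W` at least of order `n / r ^ (d - 1)`; as `d ≤ 2 * d / ε`, this is
  -- stronger than required.
  have hexp : (r : ℝ) ^ d ≤ (r : ℝ) ^ (2 * (d : ℝ) / ε) := by
    rw [← Real.rpow_natCast]
    refine Real.rpow_le_rpow_of_exponent_le hr1 ?_
    rw [le_div_iff₀ hε0]
    nlinarith
  rw [Real.rpow_sub hrpos, Real.rpow_one]
  set R : ℝ := (r : ℝ) ^ (2 * (d : ℝ) / ε)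
  have hR : 0 < R := Real.rpow_pos_of_pos hrpos _
  rw [div_div_eq_mul_div, ← mul_div_assoc, div_le_iff₀ hR]
  have h1 : (r : ℝ) * (V.card : ℝ) ^ 2 ≤ R * (256 * V.card * W.card) := by
    calc (r : ℝ) * (V.card : ℝ) ^ 2 ≤ r * (65 * A * (V.card : ℝ) ^ 2) := by
          refine mul_le_mul_of_nonneg_left ?_ hrpos.le
          exact le_mul_of_one_le_left (by positivity) (by linarith)
      _ ≤ r * ((r : ℝ) ^ d * numAP r V) := mul_le_mul_of_nonneg_left hAP' hrpos.le
      _ = (r : ℝ) ^ d * (r * numAP r V) := by ring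
      _ ≤ R * (256 * V.card * W.card) := mul_le_mul hexp hW (by positivity) hR.le
  have h2 : (V.card : ℝ) * (r * V.card) ≤ V.card * (256 * (W.card * R)) := by linarith
  have h3 := le_of_mul_le_mul_left h2 hVpos
  linarith
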